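/- Consider $\mathbb R^m$ with its lattice $\mathbb Z^m$, and write $\exp(x)=t_1^{x_1}\cdots t_m^{x_m}$ for $x\in\mathbb Z^m$. For $\Sigma\subset\mathbb R^m$ let $S(\Sigma)=\sum_{x\in\Sigma\cap\mathbb Z^m}\exp(x)$, a formal Laurent series. If there is a non-zero Laurent polynomial $\theta\in\mathbb Z[t_1^{\pm1},\ldots,t_m^{\pm1}]$ such that $\theta S(\Sigma)$ is a Laurent polynomial, then the rational function $\sigma(\Sigma)=\theta S(\Sigma)/\theta$ does not depend on $\theta$, and we say that $\sigma(\Sigma)$ is defined. A rational cone with vertex $v\in\mathbb Q^m$ is a set $\{v+\sum_{i=1}^k\alpha_iu_i:\alpha_i\ge0\}$ with finitely many $u_1,\ldots,u_k\in\mathbb Q^m$. A face of a rational cone $C$ is a non-empty set of the points of $C$ at which some linear functional attains its maximum over $C$; in particular, $C$ is a face of itself. For a face $\Gamma$ of $C$ put $C_\Gamma=\{x+\alpha(y-x):y\in C,\ \alpha\ge0\}$, where $x$ is any point of the relative interior of $\Gamma$ (the cone does not depend on $x$). **Theorem.** Let $C$ and $D$ be rational cones in $\mathbb R^m$ with the same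 vertex, let $C\subseteq D$ and $D\neq\mathbb R^m$. If $C$ contains no affine line, suppose moreover that $D$ does not contain the affine hull of $C$ (this follows from $D\ne\mathbb R^m$ when $C$ has dimension $m$). Then $C$ has finitely many faces of positive dimension, $\sigma(C)$ and all the $\sigma(C_\Gamma\cap D)$ with $\dim\Gamma>0$ are defined, and $$\sigma(C)=\sum_{\dim\Gamma>0}(-1)^{\dim\Gamma+1}\,\sigma(C_\Gamma\cap D),$$ where the sum is over the faces $\Gamma$ of $C$ of positive dimension. -/

import Mathlib

namespace RatCone

/-- The ring `ℤ[t₁^{±1}, …, t_m^{±1}]` of Laurent polynomials: the group ring of `ℤ^m`.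
The monomial `exp(x)` is `AddMonoidAlgebra.single x 1`. -/
abbrev LaurentPoly (m : ℕ) : Type := AddMonoidAlgebra ℤ (Fin m → ℤ)

/-- The field of rational functions in `t₁, …, t_m`, as the field of fractions of the (integral)
ring of Laurent polynomials. -/
abbrev RatFunField (m : ℕ) : Type := FractionRing (LaurentPoly m)

/-- Formal (two-sided infinite) Laurent series in `t₁, …, t_m`, as families of coefficients:
`f x` is the coefficient of `exp(x)`. -/
abbrev LaurentSer (m : ℕ) : Type := (Fin m → ℤ) → ℤ

/-- The product of a Laurent polynomial and a Laurent series: the `x`-th coefficient of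
`θ f` is the finite sum `∑ₐ θₐ f_{x - a}`. -/
def polyMul {m : ℕ} (θ : LaurentPoly m) (f : LaurentSer m) : LaurentSer m :=
  fun x => θ.coeff.sum fun a c => c * f (x - a)

/-- The generating series `S(Σ) = ∑_{x ∈ Σ ∩ ℤ^m} exp(x)` of a subset `Σ` of `ℝ^m`. -/
noncomputable def genSeries {m : ℕ} (s : Set (Fin m → ℝ)) : LaurentSer m :=
  Set.indicator {x : Fin m → ℤ | (fun i => (x i : ℝ)) ∈ s} 1

/-- `r` is the rational function represented by the series `S(Σ)`: for some non-zero Laurent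
polynomial `θ` the product `θ S(Σ)` is a Laurent polynomial, and `r = θ S(Σ) / θ`. -/
def Represents {m : ℕ} (s : Set (Fin m → ℝ)) (r : RatFunField m) : Prop :=
  ∃ θ p : LaurentPoly m, θ ≠ 0 ∧ polyMul θ (genSeries s) = ⇑p.coeff ∧
    r = algebraMap (LaurentPoly m) (RatFunField m) p /
      algebraMap (LaurentPoly m) (RatFunField m) θ

/-- The set `Σ` has a well-defined rational function `σ(Σ)`. -/
def HasSigma {m : ℕ} (s : Set (Fin m → ℝ)) : Prop := ∃ r, Represents s r

open Classical in
/-- The rational function `σ(Σ)`; by `Represents.sigma_eq` it does not depend on the choice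
of `θ`. (It is set to `0` when `HasSigma Σ` fails.) -/
noncomputable def sigma {m : ℕ} (s : Set (Fin m → ℝ)) : RatFunField m :=
  if h : HasSigma s then h.choose else 0

theorem polyMul_single {m : ℕ} (a : Fin m → ℤ) (c : ℤ) (f : LaurentSer m) :
    polyMul (AddMonoidAlgebra.single a c) f = fun x => c * f (x - a) := by
  funext x
  simp [polyMul]

theorem polyMul_add {m : ℕ} (θ η : LaurentPoly m) (f : LaurentSer m) :
    polyMul (θ + η) f = polyMul θ f + polyMul η f := by
  funext x
  simp only [polyMul, Pi.add_apply, AddMonoidAlgebra.coeff_add]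
  exact Finsupp.sum_add_index' (by simp) (by intros; ring)

theorem polyMul_add_right {m : ℕ} (θ : LaurentPoly m) (f g : LaurentSer m) :
    polyMul θ (f + g) = polyMul θ f + polyMul θ g := by
  funext x
  simp [polyMul, mul_add, Finsupp.sum_add]

theorem zero_polyMul {m : ℕ} (f : LaurentSer m) : polyMul 0 f = 0 := by
  funext x
  simp [polyMul]

theorem polyMul_zero {m : ℕ} (θ : LaurentPoly m) : polyMul θ 0 = 0 := by
  funext x
  simp [polyMul]

/-- `polyMul` is an action of the ring of Laurent polynomials. -/
theorem polyMul_mul {m : ℕ} (θ η : LaurentPoly m) (f : LaurentSer m) :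
    polyMul (θ * η) f = polyMul θ (polyMul η f) := by
  induction θ using AddMonoidAlgebra.induction_linear with
  | zero => simp [zero_polyMul]
  | add a b ha hb => rw [add_mul, polyMul_add, polyMul_add, ha, hb]
  | single a c =>
    induction η using AddMonoidAlgebra.induction_linear with
    | zero => simp [zero_polyMul, polyMul_zero]
    | add x y hx hy => rw [mul_add, polyMul_add, polyMul_add, polyMul_add_right, hx, hy]
    | single b d =>
      rw [AddMonoidAlgebra.single_mul_single, polyMul_single, polyMul_single, polyMul_single]
      funext x
      simp only [mul_assoc, sub_sub]

/-- On Laurent polynomials `polyMul` is the multiplication. -/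
theorem polyMul_coeff {m : ℕ} (θ p : LaurentPoly m) :
    polyMul θ ⇑p.coeff = ⇑(θ * p).coeff := by
  have h : ∀ q : LaurentPoly m, polyMul q (⇑(1 : LaurentPoly m).coeff) = ⇑q.coeff := by
    intro q
    induction q using AddMonoidAlgebra.induction_linear with
    | zero => simp [zero_polyMul]
    | add a b ha hb => rw [polyMul_add, ha, hb]; rfl
    | single a c =>
      rw [polyMul_single]
      funext x
      classical
      simp [AddMonoidAlgebra.one_def, Finsupp.single_apply, sub_eq_zero, eq_comm]
  rw [← h p, ← polyMul_mul, h]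

/-- The rational function `θ S(Σ) / θ` does not depend on `θ`. -/
theorem Represents.unique {m : ℕ} {s : Set (Fin m → ℝ)} {r r' : RatFunField m}
    (h : Represents s r) (h' : Represents s r') : r = r' := by
  obtain ⟨θ, p, hθ, hp, rfl⟩ := h
  obtain ⟨η, q, hη, hq, rfl⟩ := h'
  have key : p * η = q * θ := by
    apply AddMonoidAlgebra.coeff_injective
    apply DFunLike.coe_injective
    rw [mul_comm p, mul_comm q, ← polyMul_coeff, ← polyMul_coeff, ← hp, ← hq, ← polyMul_mul,
      ← polyMul_mul, mul_comm]
  have inj := IsFractionRing.injective (LaurentPoly m) (RatFunField m)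
  rw [div_eq_div_iff ((map_ne_zero_iff _ inj).2 hθ) ((map_ne_zero_iff _ inj).2 hη),
    ← map_mul, ← map_mul, key]

theorem Represents.sigma_eq {m : ℕ} {s : Set (Fin m → ℝ)} {r : RatFunField m}
    (h : Represents s r) : sigma s = r := by
  have hs : HasSigma s := ⟨r, h⟩
  rw [sigma, dif_pos hs]
  exact hs.choose_spec.unique h

/-- `C` is a rational (polyhedral) cone with vertex `v`: the vertex is a rational point and
`C = {v + ∑ αᵢ uᵢ, αᵢ ≥ 0}` for finitely many rational vectors `uᵢ`. -/
def IsRationalCone {m : ℕ} (v : Fin m → ℚ) (C : Set (Fin m → ℝ)) : Prop :=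
  ∃ (k : ℕ) (u : Fin k → Fin m → ℚ),
    C = {x | ∃ α : Fin k → ℝ, (∀ i, 0 ≤ α i) ∧
      ∀ j, x j = (v j : ℝ) + ∑ i, α i * (u i j : ℝ)}

/-- A set is degenerate if it contains an affine line. -/
def IsDegenerate {m : ℕ} (C : Set (Fin m → ℝ)) : Prop :=
  ∃ p w : Fin m → ℝ, w ≠ 0 ∧ ∀ a : ℝ, p + a • w ∈ C

/-- The dimension of (the affine hull of) a set. -/
noncomputable def dim {m : ℕ} (s : Set (Fin m → ℝ)) : ℕ :=
  Module.finrank ℝ (vectorSpan ℝ s)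

/-- The faces of positive dimension of a polytope `P`, the polytope `P` itself included. A face is
the set of points of `P` at which some linear functional attains its maximum over `P`. -/
def posFaces {m : ℕ} (P : Set (Fin m → ℝ)) : Set (Set (Fin m → ℝ)) :=
  {Γ | IsExposed ℝ P Γ ∧ 0 < dim Γ}

/-- The cone `P_Γ = {x + α(y - x), y ∈ P, α ≥ 0}` of a polytope `P` at its face `Γ`, where `x` is
a point of the (relative) interior of `Γ`; by `faceCone_eq` all these `x` give the same cone. -/
def faceCone {m : ℕ} (P Γ : Set (Fin m → ℝ)) : Set (Fin m → ℝ) :=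
  {z | ∃ x ∈ intrinsicInterior ℝ Γ, ∃ y ∈ P, ∃ α : ℝ, 0 ≤ α ∧ z = x + α • (y - x)}

/-- From a relative interior point one can move a little away from any other point. -/
theorem exists_pos_mem_of_mem_intrinsicInterior {m : ℕ} {Γ : Set (Fin m → ℝ)}
    {x x' : Fin m → ℝ} (hx : x ∈ Γ) (hx' : x' ∈ intrinsicInterior ℝ Γ) :
    ∃ ε : ℝ, 0 < ε ∧ x' + ε • (x' - x) ∈ Γ := by
  obtain ⟨y, hy, rfl⟩ := hx'
  have hxs : x ∈ affineSpan ℝ Γ := subset_affineSpan ℝ Γ hx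
  let g : ℝ → affineSpan ℝ Γ := fun t => ⟨(y : Fin m → ℝ) + t • ((y : Fin m → ℝ) - x), by
    have := AffineMap.lineMap_mem (1 + t) hxs y.2
    convert this using 1
    simp only [AffineMap.lineMap_apply, vsub_eq_sub, vadd_eq_add]
    module⟩
  have hg : Continuous g := by
    apply Continuous.subtype_mk
    fun_prop
  have h0 : g 0 = y := by ext1; simp [g]
  have hn : ∀ᶠ t in nhds (0 : ℝ), g t ∈ interior ((↑) ⁻¹' Γ : Set (affineSpan ℝ Γ)) :=
    hg.continuousAt.eventually_mem (by rw [h0]; exact isOpen_interior.mem_nhds hy)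
  obtain ⟨δ, hδ, h⟩ := Metric.eventually_nhds_iff.1 hn
  refine ⟨δ / 2, by positivity, ?_⟩
  have := interior_subset (@h (δ / 2) (by
    rw [dist_zero_right, Real.norm_eq_abs, abs_of_pos (by positivity)]; linarith))
  exact this

theorem faceCone_eq {m : ℕ} {P Γ : Set (Fin m → ℝ)} (hP : Convex ℝ P) (hΓ : Γ ⊆ P)
    {x : Fin m → ℝ} (hx : x ∈ intrinsicInterior ℝ Γ) :
    faceCone P Γ = {z | ∃ y ∈ P, ∃ α : ℝ, 0 ≤ α ∧ z = x + α • (y - x)} := by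
  apply Set.Subset.antisymm
  · rintro z ⟨w, hw, y, hy, α, hα, rfl⟩
    obtain ⟨ε, hε, he⟩ := exists_pos_mem_of_mem_intrinsicInterior (intrinsicInterior_subset hw) hx
    -- `w + α (y - w) = x + (w - x) + α (y - x) + (α / ε) (x + ε (x - w) - x)`
    have hs : 0 < 1 + α + α / ε := by positivity
    refine ⟨(1 / (1 + α + α / ε)) • w + (α / (1 + α + α / ε)) • y
      + (α / ε / (1 + α + α / ε)) • (x + ε • (x - w)), ?_, 1 + α + α / ε, hs.le, ?_⟩
    · have h3 := hP.sum_mem (t := Finset.univ)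
        (w := ![1 / (1 + α + α / ε), α / (1 + α + α / ε), α / ε / (1 + α + α / ε)])
        (z := ![w, y, x + ε • (x - w)])
        (by intro i _; fin_cases i <;> simp <;> positivity)
        (by simp [Fin.sum_univ_three]; field_simp)
        (by
          intro i _
          fin_cases i
          · exact hΓ (intrinsicInterior_subset hw)
          · exact hy
          · exact hΓ he)
      simpa [Fin.sum_univ_three] using h3
    · ext j
      simp only [Pi.add_apply, Pi.smul_apply, Pi.sub_apply, smul_eq_mul]
      field_simp
      ring
  · rintro z ⟨y, hy, α, hα, rfl⟩
    exact ⟨x, hx, y, hy, α, hα, rfl⟩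

end RatCone

/-! Move the vertex to the origin: C and D become cones K ⊆ L, the faces of C become the faces G of
K, and C_Γ becomes `tangent K G` = K - G.

If C contains a line, some non-zero integer vector w has ±w ∈ K (`exists_int_line`). All sets in the
formula are invariant under translation by w, so 1 - exp(w) annihilates their series and both sides
are 0.

Otherwise {0} is a face with tangent cone K, and the formula holds already for the series
(`genSeries_shift`). Its core is `sum_tangent_eq_zero`: the sum of (-1)^dim G [x ∈ K - G] over all
faces G vanishes unless -x is in the relative interior of K. No x ∈ L is such an exception, since L
would then contain the span of K. Restrict to L and isolate G = {0}.

For this identity, perturb x until it avoids the spans of proper faces. If x lies in the span of K,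
each relative interior point of K, pushed along -x, leaves K through exactly one proper open face G,
and x ∈ K - G. This cuts the interior into relatively open convex pieces of dimension dim G + 1, and
additivity of (-1)^dim (`sum_euler_eq_zero`) finishes.

The rational functions exist because the lattice points of a rational cone, or of an intersection of
two, form finitely many translates of a finitely generated monoid (`FinGen.exists_seriesRep`). -/

namespace RatCone

open Filter Topology Module

/-! ### Additivity of the Euler characteristic on relatively open convex sets. -/

section Euler

variable {E : Type*} [AddCommGroup E] [Module ℝ E]

/-- A convex set is *segment-open* if every segment between two of its points can be prolonged
a little inside the set. For convex sets in finite dimension this is the same as being relatively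
open. -/
def SegOpen (U : Set E) : Prop :=
  Convex ℝ U ∧ ∀ y ∈ U, ∀ z ∈ U, ∃ ε : ℝ, 0 < ε ∧ z + ε • (z - y) ∈ U

theorem SegOpen.exists_forall_le {U : Set E} (hU : SegOpen U) {y z : E} (hy : y ∈ U) (hz : z ∈ U) :
    ∃ ε : ℝ, 0 < ε ∧ ∀ δ, 0 ≤ δ → δ ≤ ε → z + δ • (z - y) ∈ U := by
  obtain ⟨ε, hε, h⟩ := hU.2 y hy z hz
  refine ⟨ε, hε, fun δ h0 h1 => ?_⟩
  convert hU.1 hz h (show 0 ≤ 1 - δ / ε by rw [sub_nonneg, div_le_one hε]; exact h1)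
    (show 0 ≤ δ / ε by positivity) (by ring) using 1
  have : δ / ε * ε = δ := div_mul_cancel₀ _ hε.ne'
  nth_rewrite 1 [← this]
  module

theorem SegOpen.inter {U V : Set E} (hU : SegOpen U) (hV : SegOpen V) : SegOpen (U ∩ V) := by
  refine ⟨hU.1.inter hV.1, fun y hy z hz => ?_⟩
  obtain ⟨ε, hε, h⟩ := hU.exists_forall_le hy.1 hz.1
  obtain ⟨δ, hδ, h'⟩ := hV.exists_forall_le hy.2 hz.2
  exact ⟨min ε δ, lt_min hε hδ, h _ (lt_min hε hδ).le (min_le_left _ _),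
    h' _ (lt_min hε hδ).le (min_le_right _ _)⟩

theorem SegOpen.image {F : Type*} [AddCommGroup F] [Module ℝ F] {U : Set E} (hU : SegOpen U)
    (l : E →ₗ[ℝ] F) : SegOpen (l '' U) := by
  refine ⟨hU.1.linear_image l, ?_⟩
  rintro _ ⟨y, hy, rfl⟩ _ ⟨z, hz, rfl⟩
  obtain ⟨ε, hε, h⟩ := hU.2 y hy z hz
  exact ⟨ε, hε, _, h, by simp⟩

theorem segOpen_fiber (l : E →ₗ[ℝ] ℝ) (t : ℝ) : SegOpen {x | l x = t} := by
  refine ⟨fun x hx y hy a b _ _ hab => ?_, fun y hy z hz => ⟨1, one_pos, ?_⟩⟩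
  · simp only [Set.mem_ofPred_eq] at *
    rw [map_add, map_smul, map_smul, hx, hy, ← add_smul, hab, one_smul]
  · simp only [Set.mem_ofPred_eq] at *
    simp [hy, hz]

/-- The directions in which one can move from u both ways inside U form a subspace, and it contains
all y - u with y ∈ U. -/
theorem SegOpen.exists_add_smul_mem {U : Set E} (hU : SegOpen U) {u w : E} (hu : u ∈ U)
    (hw : w ∈ vectorSpan ℝ U) : ∃ ε : ℝ, 0 < ε ∧ u + ε • w ∈ U := by
  rw [vectorSpan_eq_span_vsub_set_right ℝ hu] at hw
  have comb : ∀ {x y : E}, x ∈ U → y ∈ U → ∀ a : ℝ, 0 ≤ a → a ≤ 1 → (1 - a) • x + a • y ∈ U :=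
    fun hx hy a h0 h1 => hU.1 hx hy (by linarith) h0 (by ring)
  have key : (∃ ε : ℝ, 0 < ε ∧ u + ε • w ∈ U) ∧ ∃ ε : ℝ, 0 < ε ∧ u - ε • w ∈ U := by
    induction hw using Submodule.span_induction with
    | mem x hx =>
      obtain ⟨y, hy, rfl⟩ := hx
      obtain ⟨ε, hε, h⟩ := hU.2 y hy u hu
      refine ⟨⟨1, one_pos, by simpa using hy⟩, ε, hε, ?_⟩
      convert h using 1
      simp only [vsub_eq_sub]
      module
    | zero => exact ⟨⟨1, one_pos, by simpa⟩, 1, one_pos, by simpa⟩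
    | add x y _ _ hx hy =>
      have aux : ∀ p q : E, (∃ ε : ℝ, 0 < ε ∧ u + ε • p ∈ U) → (∃ ε : ℝ, 0 < ε ∧ u + ε • q ∈ U) →
          ∃ ε : ℝ, 0 < ε ∧ u + ε • (p + q) ∈ U := by
        rintro p q ⟨ε, hε, h⟩ ⟨δ, hδ, h'⟩
        -- The weights δ/(ε+δ) and ε/(ε+δ) on u + ε p and u + δ q give p and q the same coefficient.
        refine ⟨ε * δ / (ε + δ), by positivity, ?_⟩
        convert comb h h' (ε / (ε + δ)) (by positivity)
          (by rw [div_le_one (by positivity)]; linarith) using 1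
        have h1 : ε * δ / (ε + δ) = (1 - ε / (ε + δ)) * ε := by field_simp; ring
        have h2 : ε * δ / (ε + δ) = (ε / (ε + δ)) * δ := by field_simp
        rw [smul_add]
        nth_rewrite 1 [h1]
        rw [h2]
        module
      refine ⟨aux _ _ hx.1 hy.1, ?_⟩
      have := aux (-x) (-y) (by simpa [sub_eq_add_neg] using hx.2)
        (by simpa [sub_eq_add_neg] using hy.2)
      simpa [sub_eq_add_neg, add_comm] using this
    | smul a x _ hx =>
      rcases lt_trichotomy a 0 with ha | rfl | ha
      · obtain ⟨⟨ε, hε, h⟩, δ, hδ, h'⟩ := hx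
        refine ⟨⟨δ / (-a), div_pos hδ (by linarith), ?_⟩, ε / (-a), div_pos hε (by linarith), ?_⟩
        · convert h' using 1
          rw [smul_smul, div_mul_eq_mul_div, div_neg, mul_div_assoc, div_self ha.ne]
          module
        · convert h using 1
          rw [smul_smul, div_mul_eq_mul_div, div_neg, mul_div_assoc, div_self ha.ne]
          module
      · exact ⟨⟨1, one_pos, by simpa⟩, 1, one_pos, by simpa⟩
      · obtain ⟨⟨ε, hε, h⟩, δ, hδ, h'⟩ := hx
        refine ⟨⟨ε / a, by positivity, ?_⟩, δ / a, by positivity, ?_⟩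
        · rwa [smul_smul, div_mul_cancel₀ _ ha.ne']
        · rwa [smul_smul, div_mul_cancel₀ _ ha.ne']
  exact key.1

/-- This makes the dimension of a non-empty fibre independent of the level. -/
theorem SegOpen.vectorSpan_fiber {U : Set E} (hU : SegOpen U) (l : E →ₗ[ℝ] ℝ) {u : E}
    (hu : u ∈ U) : vectorSpan ℝ (U ∩ {x | l x = l u}) = vectorSpan ℝ U ⊓ LinearMap.ker l := by
  have hmem : u ∈ U ∩ {x | l x = l u} := ⟨hu, rfl⟩
  apply le_antisymm
  · refine le_inf (vectorSpan_mono ℝ Set.inter_subset_left) ?_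
    rw [vectorSpan_eq_span_vsub_set_right ℝ hmem, Submodule.span_le]
    rintro _ ⟨y, hy, rfl⟩
    have : l y = l u := hy.2
    simp [this]
  · rintro w ⟨hw, hl⟩
    obtain ⟨ε, hε, h⟩ := hU.exists_add_smul_mem hu hw
    have hl : l w = 0 := hl
    have h2 : u + ε • w ∈ U ∩ {x | l x = l u} := ⟨h, by simp [hl]⟩
    have := vsub_mem_vectorSpan ℝ h2 hmem
    simp only [vsub_eq_sub, add_sub_cancel_left] at this
    exact (Submodule.smul_mem_iff _ hε.ne').1 this

theorem map_eq_of_mem_of_le_ker {U : Set E} {l : E →ₗ[ℝ] ℝ}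
    (h : vectorSpan ℝ U ≤ LinearMap.ker l) {x y : E} (hx : x ∈ U) (hy : y ∈ U) : l x = l y := by
  have := h (vsub_mem_vectorSpan ℝ hx hy)
  simpa [sub_eq_zero] using this

-- Multiplicativity of (-1)^dim for U → l(U): either l is constant on U, or the image is an open
-- interval and fibres lose one dimension.
open Classical in
theorem SegOpen.neg_one_pow_fiber [FiniteDimensional ℝ E] {U : Set E} (hU : SegOpen U)
    (l : E →ₗ[ℝ] ℝ) {u : E} (hu : u ∈ U) :
    (-1 : ℤ) ^ finrank ℝ (vectorSpan ℝ U) =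
      (-1) ^ finrank ℝ (vectorSpan ℝ (U ∩ {x | l x = l u})) *
        if (l '' U).Subsingleton then 1 else -1 := by
  rw [hU.vectorSpan_fiber l hu]
  by_cases h : vectorSpan ℝ U ≤ LinearMap.ker l
  · rw [inf_eq_left.2 h, if_pos, mul_one]
    rintro _ ⟨x, hx, rfl⟩ _ ⟨y, hy, rfl⟩
    exact map_eq_of_mem_of_le_ker h hx hy
  · rw [if_neg]
    · have hne : l.domRestrict (vectorSpan ℝ U) ≠ 0 := by
        intro h0
        apply h
        intro x hx
        exact LinearMap.congr_fun h0 ⟨x, hx⟩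
      have h1 := Module.Dual.finrank_ker_add_one_of_ne_zero hne
      rw [← h1, pow_succ]
      congr 2
      rw [← Submodule.finrank_map_subtype_eq]
      rw [LinearMap.domRestrict, LinearMap.ker_comp, Submodule.map_comap_subtype]
    · intro hs
      apply h
      rw [vectorSpan_eq_span_vsub_set_right ℝ hu, Submodule.span_le]
      rintro _ ⟨y, hy, rfl⟩
      have := hs (Set.mem_image_of_mem l hy) (Set.mem_image_of_mem l hu)
      simp [this]

/-! ### Open intervals and points of the line -/

-- Along F all memberships are eventually settled, so `h` at one suitable point gives the relation
-- between germs. It serves for germs to the right of t and at -∞.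
open Classical in
theorem sum_eventually_mem_eq_zero {ι X : Type*} {s : Finset ι} {c : ι → ℤ} {J : ι → Set X}
    (h : ∀ x, ∑ i ∈ s, c i * (if x ∈ J i then 1 else 0) = 0) (F : Filter X) [F.NeBot]
    (hF : ∀ i ∈ s, (∀ᶠ x in F, x ∈ J i) ∨ ∀ᶠ x in F, x ∉ J i) :
    ∑ i ∈ s, c i * (if ∀ᶠ x in F, x ∈ J i then 1 else 0) = 0 := by
  have : ∀ᶠ x in F, ∀ i ∈ s, (x ∈ J i ↔ ∀ᶠ x in F, x ∈ J i) := by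
    rw [Finset.eventually_all]
    intro i hi
    rcases hF i hi with h | h
    · exact h.mono fun x hx => iff_of_true hx h
    · refine h.mono fun x hx => iff_of_false hx fun h' => ?_
      obtain ⟨y, hy, hy'⟩ := (h.and h').exists
      exact hy hy'
  obtain ⟨x, hx⟩ := this.exists
  refine Eq.trans (Finset.sum_congr rfl fun i hi => ?_) (h x)
  simp only [hx i hi]

theorem eventually_nhdsGT_of_ordConnected {J : Set ℝ} (hJ : J.OrdConnected) (t : ℝ) :
    (∀ᶠ x in 𝓝[>] t, x ∈ J) ∨ ∀ᶠ x in 𝓝[>] t, x ∉ J := by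
  by_contra! h
  obtain ⟨h1, h2⟩ := h
  obtain ⟨y, hy, hyt⟩ := (h2.and_eventually self_mem_nhdsWithin).exists
  obtain ⟨x, hx, hxt⟩ := (h1.and_eventually (Ioo_mem_nhdsGT hyt)).exists
  obtain ⟨z, hz, hzt⟩ := (h2.and_eventually (Ioo_mem_nhdsGT hxt.1)).exists
  exact hx (hJ.out hz hy ⟨hzt.2.le, hxt.2.le⟩)

theorem eventually_atBot_of_ordConnected {J : Set ℝ} (hJ : J.OrdConnected) :
    (∀ᶠ x in atBot, x ∈ J) ∨ ∀ᶠ x in atBot, x ∉ J := by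
  by_contra! h
  obtain ⟨h1, h2⟩ := h
  obtain ⟨y, hy⟩ := h2.exists
  obtain ⟨x, hx, hxt⟩ := (h1.and_eventually (Iic_mem_atBot y)).exists
  obtain ⟨z, hz, hzt⟩ := (h2.and_eventually (Iic_mem_atBot x)).exists
  exact hx (hJ.out hz hy ⟨hzt, hxt⟩)

theorem SegOpen.exists_gt {J : Set ℝ} (hJ : SegOpen J) (hs : ¬ J.Subsingleton) {t : ℝ}
    (ht : t ∈ J) : (∃ u ∈ J, t < u) ∧ ∃ u ∈ J, u < t := by
  obtain ⟨u, hu, hut⟩ : ∃ u ∈ J, u ≠ t := by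
    by_contra! h
    exact hs fun x hx y hy => (h x hx).trans (h y hy).symm
  obtain ⟨ε, hε, h⟩ := hJ.2 u hu t ht
  rw [smul_eq_mul] at h
  rcases lt_or_gt_of_ne hut with h1 | h1
  · exact ⟨⟨_, h, by nlinarith⟩, u, hu, h1⟩
  · exact ⟨⟨u, hu, h1⟩, _, h, by nlinarith⟩

open Classical in
/-- The Euler characteristic of a point or an open interval, computed by jumps. -/
theorem SegOpen.exists_sum_jump {J : Set ℝ} (hJ : SegOpen J) (hne : J.Nonempty) :
    ∃ T₀ : Finset ℝ, ∀ T, T₀ ⊆ T →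
      ∑ t ∈ T, ((if t ∈ J then 1 else 0) - if ∀ᶠ x in 𝓝[>] t, x ∈ J then (1 : ℤ) else 0)
        - (if ∀ᶠ x in atBot, x ∈ J then 1 else 0) = if J.Subsingleton then 1 else -1 := by
  have hoc : J.OrdConnected := hJ.1.ordConnected
  -- A point contributes 1 at itself. An interval contributes -1, at its infimum or, if unbounded
  -- below, at -∞; elsewhere, also at its right end, the terms cancel.
  by_cases hs : J.Subsingleton
  · obtain ⟨a, rfl⟩ := (Set.exists_eq_singleton_iff_nonempty_subsingleton).2 ⟨hne, hs⟩
    refine ⟨{a}, fun T hT => ?_⟩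
    have h1 : ∀ t, ¬ ∀ᶠ x in 𝓝[>] t, x ∈ ({a} : Set ℝ) := by
      intro t h
      obtain ⟨x, hx, hxt⟩ := (h.and self_mem_nhdsWithin).exists
      obtain ⟨y, hy, hyt⟩ := (h.and (Ioo_mem_nhdsGT hxt)).exists
      rw [Set.mem_singleton_iff] at hx hy
      subst hx hy
      exact lt_irrefl _ hyt.2
    have h2 : ¬ ∀ᶠ x in atBot, x ∈ ({a} : Set ℝ) := by
      intro h
      obtain ⟨x, hx, hxt⟩ := (h.and (Iio_mem_atBot a)).exists
      rw [Set.mem_singleton_iff] at hx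
      subst hx
      exact lt_irrefl _ hxt
    simp only [h1, h2, if_false, sub_zero, hs, if_true]
    have ha : a ∈ T := hT (Finset.mem_singleton_self a)
    simp [ha]
  · simp only [hs, if_false]
    have hout : ∀ t ∉ J, (∃ y ∈ J, y < t) → ¬ ∀ᶠ x in 𝓝[>] t, x ∈ J := by
      rintro t ht ⟨y, hy, hyt⟩ h
      obtain ⟨x, hx, hxt⟩ := (h.and self_mem_nhdsWithin).exists
      exact ht (hoc.out hy hx ⟨hyt.le, le_of_lt hxt⟩)
    have hin : ∀ t ∈ J, ∀ᶠ x in 𝓝[>] t, x ∈ J := by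
      intro t ht
      obtain ⟨u, hu, hut⟩ := (hJ.exists_gt hs ht).1
      exact Filter.mem_of_superset (Ioo_mem_nhdsGT hut)
        fun x hx => hoc.out ht hu ⟨hx.1.le, hx.2.le⟩
    by_cases hb : BddBelow J
    · have ha : sInf J ∉ J := by
        intro ha
        obtain ⟨u, hu, hut⟩ := (hJ.exists_gt hs ha).2
        exact hut.not_ge (csInf_le hb hu)
      have hbot : ¬ ∀ᶠ x in atBot, x ∈ J := by
        intro h
        obtain ⟨x, hx, hxt⟩ := (h.and (Iio_mem_atBot (sInf J))).exists
        exact (csInf_le hb hx).not_gt hxt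
      have hr : ∀ᶠ x in 𝓝[>] (sInf J), x ∈ J := by
        obtain ⟨y, hy⟩ := hne
        have hya : sInf J < y := lt_of_le_of_ne (csInf_le hb hy) (by rintro h; exact ha (h ▸ hy))
        refine Filter.mem_of_superset (Ioo_mem_nhdsGT hya) fun x hx => ?_
        obtain ⟨z, hz, hzx⟩ := exists_lt_of_csInf_lt ⟨y, hy⟩ hx.1
        exact hoc.out hz hy ⟨hzx.le, hx.2.le⟩
      have hl : ∀ t < sInf J, ¬ ∀ᶠ x in 𝓝[>] t, x ∈ J := by
        intro t ht h
        obtain ⟨x, hx, hxt⟩ := (h.and (Ioo_mem_nhdsGT ht)).exists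
        exact (csInf_le hb hx).not_gt hxt.2
      refine ⟨{sInf J}, fun T hT => ?_⟩
      rw [Finset.sum_eq_single_of_mem (sInf J) (hT (Finset.mem_singleton_self _))]
      · simp [ha, hr, hbot]
      · intro t _ hta
        by_cases ht : t ∈ J
        · simp [ht, hin t ht]
        · rcases lt_or_gt_of_ne hta with h | h
          · simp [ht, hl t h]
          · obtain ⟨z, hz, hzx⟩ := exists_lt_of_csInf_lt hne h
            simp [ht, hout t ht ⟨z, hz, hzx⟩]
    · have hlow : ∀ t, ∃ y ∈ J, y < t := by
        intro t
        by_contra! h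
        exact hb ⟨t, fun y hy => h y hy⟩
      have hbot : ∀ᶠ x in atBot, x ∈ J := by
        obtain ⟨y, hy⟩ := hne
        refine Filter.mem_of_superset (Iic_mem_atBot y) fun x hx => ?_
        obtain ⟨z, hz, hzx⟩ := hlow x
        exact hoc.out hz hy ⟨hzx.le, hx⟩
      refine ⟨∅, fun T _ => ?_⟩
      rw [Finset.sum_eq_zero]
      · simp [hbot]
      · intro t _
        by_cases ht : t ∈ J
        · simp [ht, hin t ht]
        · simp [ht, hout t ht (hlow t)]

open Classical in
theorem sum_euler_real {ι : Type*} {s : Finset ι} {c : ι → ℤ} {J : ι → Set ℝ}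
    (hJ : ∀ i ∈ s, SegOpen (J i)) (hne : ∀ i ∈ s, (J i).Nonempty)
    (h : ∀ x, ∑ i ∈ s, c i * (if x ∈ J i then 1 else 0) = 0) :
    ∑ i ∈ s, c i * (if (J i).Subsingleton then 1 else -1) = 0 := by
  choose! T₀ hT₀ using fun i (hi : i ∈ s) => (hJ i hi).exists_sum_jump (hne i hi)
  have h1 := fun i (hi : i ∈ s) => hT₀ i hi (s.biUnion T₀) (Finset.subset_biUnion_of_mem T₀ hi)
  rw [Finset.sum_congr rfl fun i hi => by rw [← h1 i hi]]
  -- The jump formula, over one set of points common to all J i, is linear in the indicators, so it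
  -- inherits the relation `h` term by term.
  simp only [mul_sub, Finset.mul_sum, Finset.sum_sub_distrib]
  rw [Finset.sum_comm, Finset.sum_comm (s := s), Finset.sum_eq_zero fun t _ => h t, sum_eventually_mem_eq_zero h _ fun i hi => eventually_atBot_of_ordConnected (hJ i hi).1.ordConnected,
    Finset.sum_eq_zero fun t _ => sum_eventually_mem_eq_zero h (𝓝[>] t)
      fun i hi => eventually_nhdsGT_of_ordConnected (hJ i hi).1.ordConnected t]
  simp

open Classical in
/-- The Euler characteristic `U ↦ (-1) ^ dim U` of relatively open convex sets is additive. -/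
theorem sum_euler_eq_zero [FiniteDimensional ℝ E] {ι : Type*} {s : Finset ι} {c : ι → ℤ}
    {U : ι → Set E} (hU : ∀ i ∈ s, SegOpen (U i)) (hne : ∀ i ∈ s, (U i).Nonempty)
    (h : ∀ x, ∑ i ∈ s, c i * (if x ∈ U i then 1 else 0) = 0) :
    ∑ i ∈ s, c i * (-1) ^ finrank ℝ (vectorSpan ℝ (U i)) = 0 := by
  -- Induction on the dimension of a subspace W containing the differences of points of all the
  -- sets, also of different ones.
  suffices H : ∀ (n : ℕ) (W : Submodule ℝ E), finrank ℝ W = n → ∀ (s : Finset ι) (c : ι → ℤ)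
      (U : ι → Set E), (∀ i ∈ s, SegOpen (U i)) → (∀ i ∈ s, (U i).Nonempty) →
      (∀ x, ∑ i ∈ s, c i * (if x ∈ U i then 1 else 0) = 0) →
      (∀ i ∈ s, ∀ j ∈ s, ∀ x ∈ U i, ∀ y ∈ U j, x - y ∈ W) →
      ∑ i ∈ s, c i * (-1) ^ finrank ℝ (vectorSpan ℝ (U i)) = 0 from
    H _ ⊤ rfl s c U hU hne h (by simp)
  intro n
  induction n with
  | zero =>
    intro W hW s c U hU hne h hsub
    rw [Submodule.finrank_eq_zero] at hW
    subst hW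
    rcases s.eq_empty_or_nonempty with rfl | ⟨i₀, hi₀⟩
    · simp
    obtain ⟨p, hp⟩ := hne i₀ hi₀
    have hUp : ∀ i ∈ s, U i = {p} := by
      intro i hi
      refine Set.eq_singleton_iff_nonempty_unique_mem.2 ⟨hne i hi, fun x hx => ?_⟩
      have := hsub i hi i₀ hi₀ x hx p hp
      simpa [sub_eq_zero] using this
    refine Eq.trans (Finset.sum_congr rfl fun i hi => ?_) (h p)
    have : vectorSpan ℝ ({p} : Set E) = ⊥ := vectorSpan_singleton ℝ p
    rw [hUp i hi, this]
    simp
  | succ n ih =>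
    intro W hW s c U hU hne h hsub
    have hW0 : W ≠ ⊥ := by
      rintro rfl
      simp at hW
    obtain ⟨w, hw, hw0⟩ := W.ne_bot_iff.1 hW0
    obtain ⟨l, hl⟩ : ∃ l : Module.Dual ℝ E, l w ≠ 0 := by
      by_contra! hc
      exact hw0 ((Module.forall_dual_apply_eq_zero_iff ℝ w).1 hc)
    have hWl : finrank ℝ (W ⊓ LinearMap.ker l : Submodule ℝ E) = n := by
      have hne : l.domRestrict W ≠ 0 := fun h0 => hl (LinearMap.congr_fun h0 ⟨w, hw⟩)
      have h1 := Module.Dual.finrank_ker_add_one_of_ne_zero hne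
      rw [← Submodule.finrank_map_subtype_eq, LinearMap.domRestrict, LinearMap.ker_comp,
        Submodule.map_comap_subtype, hW] at h1
      omega
    choose! u hu using hne
    -- Slice at level t: the fibres have differences in W ∩ ker l. Their signs are those of U i up
    -- to a factor independent of t, so the slices give a relation between the intervals l(U i).
    have key : ∀ t : ℝ, ∑ i ∈ s, (c i * (-1) ^ finrank ℝ (vectorSpan ℝ (U i)) *
        (if (l '' U i).Subsingleton then 1 else -1)) * (if t ∈ l '' U i then 1 else 0) = 0 := by
      intro t
      have := ih _ hWl (s.filter fun i => t ∈ l '' U i) c (fun i => U i ∩ {x | l x = t})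
        (fun i hi => (hU i (Finset.mem_filter.1 hi).1).inter (segOpen_fiber l t))
        (fun i hi => by
          obtain ⟨x, hx, hxt⟩ := (Finset.mem_filter.1 hi).2
          exact ⟨x, hx, hxt⟩)
        (fun x => by
          rw [Finset.sum_filter]
          by_cases hx : l x = t
          · refine Eq.trans (Finset.sum_congr rfl fun i _ => ?_) (h x)
            by_cases hxi : x ∈ U i
            · rw [if_pos ⟨x, hxi, hx⟩]
              simp [hx]
            · simp [hxi]
          · simp [hx])
        (fun i hi j hj x hx y hy => ⟨hsub i (Finset.mem_filter.1 hi).1 j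
          (Finset.mem_filter.1 hj).1 x hx.1 y hy.1, by
            have h1 : l x = t := hx.2
            have h2 : l y = t := hy.2
            simp [h1, h2]⟩)
      rw [Finset.sum_filter] at this
      refine Eq.trans (Finset.sum_congr rfl fun i hi => ?_) this
      by_cases ht : t ∈ l '' U i
      · obtain ⟨x, hx, rfl⟩ := ht
        rw [if_pos (Set.mem_image_of_mem l hx), if_pos (Set.mem_image_of_mem l hx),
          (hU i hi).neg_one_pow_fiber l hx]
        split_ifs <;> ring
      · simp [ht]
    have := sum_euler_real (fun i hi => (hU i hi).image l) (fun i hi => ⟨_, u i, hu i hi, rfl⟩) key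
    refine Eq.trans (Finset.sum_congr rfl fun i _ => ?_) this
    split_ifs <;> ring

end Euler
end RatCone

namespace RatCone

open Filter Topology Module

/-! ### Finitely generated cones: closedness, faces, tangent cones. -/

section Cone

variable {E : Type*} [AddCommGroup E] [Module ℝ E]

theorem mem_hull_range_iff {ι : Type*} [Fintype ι] {u : ι → E} {x : E} :
    x ∈ PointedCone.hull ℝ (Set.range u) ↔ ∃ α : ι → ℝ, (∀ i, 0 ≤ α i) ∧ x = ∑ i, α i • u i := by
  rw [PointedCone.hull, Submodule.mem_span_range_iff_exists_fun]
  constructor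
  · rintro ⟨c, rfl⟩
    exact ⟨fun i => c i, fun i => (c i).2, rfl⟩
  · rintro ⟨α, hα, rfl⟩
    exact ⟨fun i => ⟨α i, hα i⟩, rfl⟩

theorem exists_fin_of_fg {K : PointedCone ℝ E} (hK : K.FG) :
    ∃ (k : ℕ) (u : Fin k → E), K = PointedCone.hull ℝ (Set.range u) := by
  obtain ⟨k, u, hu⟩ := Submodule.fg_iff_exists_fin_generating_family.1 hK
  exact ⟨k, u, hu.symm⟩

/-- **Carathéodory's theorem** for cones. -/
theorem exists_linearIndepOn_of_mem_hull {ι : Type*} [Fintype ι] {u : ι → E} {x : E}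
    (hx : x ∈ PointedCone.hull ℝ (Set.range u)) :
    ∃ s : Finset ι, LinearIndepOn ℝ u (s : Set ι) ∧ ∃ α : ι → ℝ, (∀ i, 0 ≤ α i) ∧
      x = ∑ i ∈ s, α i • u i := by
  classical
  let P : Finset ι → Prop := fun s => ∃ α : ι → ℝ, (∀ i, 0 ≤ α i) ∧ x = ∑ i ∈ s, α i • u i
  have hP : P Finset.univ := mem_hull_range_iff.1 hx
  obtain ⟨s, hs, hmin⟩ := Finset.exists_min_image (Finset.univ.filter P) Finset.card
    ⟨Finset.univ, by simpa using hP⟩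
  have hs' : P s := by simpa using hs
  refine ⟨s, ?_, hs'⟩
  obtain ⟨α, hα, rfl⟩ := hs'
  rw [linearIndepOn_finset_iff]
  by_contra! hdep
  obtain ⟨β, hβ, j₀, hj₀, hj₀'⟩ : ∃ β : ι → ℝ, ∑ i ∈ s, β i • u i = 0 ∧ ∃ j ∈ s, 0 < β j := by
    obtain ⟨β, hβ, j, hj, hj'⟩ := hdep
    rcases lt_or_gt_of_ne hj' with h | h
    · exact ⟨-β, by simpa using hβ, j, hj, by simpa using h⟩
    · exact ⟨β, hβ, j, hj, h⟩
  -- Subtract the largest multiple of the dependence that keeps all coefficients non-negative; it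
  -- kills the coefficient of j, against minimality of s.
  obtain ⟨j, hj, hjmin⟩ := Finset.exists_min_image (s.filter fun i => 0 < β i)
    (fun i => α i / β i) ⟨j₀, by simp [hj₀, hj₀']⟩
  obtain ⟨hjs, hjβ⟩ := Finset.mem_filter.1 hj
  have hlt : (s.erase j).card < s.card := Finset.card_erase_lt_of_mem hjs
  refine hlt.not_ge (hmin _ ?_)
  have ht : 0 ≤ α j / β j := div_nonneg (hα j) hjβ.le
  simp only [Finset.mem_filter, Finset.mem_univ, true_and]
  refine ⟨fun i => if i ∈ s then α i - α j / β j * β i else 0, fun i => ?_, ?_⟩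
  · beta_reduce
    split_ifs with his
    · rcases le_or_gt (β i) 0 with h | h
      · have := mul_nonpos_of_nonneg_of_nonpos ht h
        linarith [hα i]
      · have := hjmin i (by simp [his, h])
        rw [le_div_iff₀ h] at this
        linarith
    · exact le_rfl
  · have h1 : ∑ i ∈ s, (if i ∈ s then α i - α j / β j * β i else 0) • u i = ∑ i ∈ s, α i • u i := by
      rw [Finset.sum_congr rfl fun i hi => by rw [if_pos hi, sub_smul, mul_smul],
        Finset.sum_sub_distrib, ← Finset.smul_sum, hβ, smul_zero, sub_zero]
    rw [← h1, ← Finset.add_sum_erase _ _ hjs, if_pos hjs, div_mul_cancel₀ _ hjβ.ne', sub_self,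
      zero_smul, zero_add]

/-- By Carathéodory the cone is a finite union of images of closed orthants under injective linear
maps. -/
theorem isClosed_of_fg {E : Type*} [NormedAddCommGroup E] [NormedSpace ℝ E]
    [FiniteDimensional ℝ E] {K : PointedCone ℝ E} (hK : K.FG) : IsClosed (K : Set E) := by
  classical
  obtain ⟨k, u, rfl⟩ := exists_fin_of_fg hK
  have : (PointedCone.hull ℝ (Set.range u) : Set E) =
      ⋃ s ∈ {s : Finset (Fin k) | LinearIndepOn ℝ u (s : Set (Fin k))},
        Fintype.linearCombination ℝ (fun i : s => u i) '' {α | ∀ i, 0 ≤ α i} := by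
    ext x
    simp only [SetLike.mem_coe, Set.mem_iUnion, exists_prop]
    constructor
    · intro hx
      obtain ⟨s, hs, α, hα, rfl⟩ := exists_linearIndepOn_of_mem_hull hx
      refine ⟨s, hs, fun i => α i, fun i => hα i, ?_⟩
      rw [Fintype.linearCombination_apply, Finset.sum_coe_sort s fun i => α i • u i]
    · rintro ⟨s, -, α, hα, rfl⟩
      rw [Fintype.linearCombination_apply]
      exact Submodule.sum_mem _ fun i _ => PointedCone.smul_mem _ (hα i)
        (Submodule.subset_span ⟨i, rfl⟩)
  rw [this]
  refine Set.Finite.isClosed_biUnion (Set.toFinite _) fun s hs => ?_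
  have hinj : LinearMap.ker (Fintype.linearCombination ℝ (fun i : s => u i)) = ⊥ := by
    rw [LinearMap.ker_eq_bot']
    intro α hα
    rw [Fintype.linearCombination_apply] at hα
    exact funext (Fintype.linearIndependent_iff.1 hs α hα)
  refine (LinearMap.isClosedEmbedding_of_injective hinj).isClosedMap _ ?_
  simp only [Set.ofPred_forall]
  exact isClosed_iInter fun i => isClosed_le continuous_const (continuous_apply i)

/-- **Farkas' lemma** -/
theorem exists_separating_of_fg {E : Type*} [NormedAddCommGroup E] [NormedSpace ℝ E]
    [FiniteDimensional ℝ E] {K : PointedCone ℝ E} (hK : K.FG) {x : E} (hx : x ∉ K) :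
    ∃ l : E →L[ℝ] ℝ, (∀ y ∈ K, l y ≤ 0) ∧ 0 < l x := by
  obtain ⟨l, h1, h2⟩ := ProperCone.hyperplane_separation_point ⟨K, isClosed_of_fg hK⟩ hx
  exact ⟨-l, fun y hy => by simpa using h1 y hy, by simpa using h2⟩

/-- The cone `K - G` of all directions `w` that point from some point of `G` into `K`. -/
def tangent (K G : PointedCone ℝ E) : PointedCone ℝ E where
  carrier := {w | ∃ z ∈ G, w + z ∈ K}
  zero_mem' := ⟨0, zero_mem _, by simp⟩
  add_mem' := by
    rintro a b ⟨z, hz, h⟩ ⟨z', hz', h'⟩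
    exact ⟨z + z', add_mem hz hz', by rw [add_add_add_comm]; exact add_mem h h'⟩
  smul_mem' := by
    rintro c a ⟨z, hz, h⟩
    exact ⟨c • z, Submodule.smul_mem _ c hz, by rw [← smul_add]; exact Submodule.smul_mem _ c h⟩

/-- The smallest face of the cone `K` that contains `y`. -/
def minFace (K : PointedCone ℝ E) (y : E) : PointedCone ℝ E where
  carrier := {w | w ∈ K ∧ ∃ s : ℝ, 0 ≤ s ∧ s • y - w ∈ K}
  zero_mem' := ⟨zero_mem _, 0, le_rfl, by simp⟩
  add_mem' := by
    rintro a b ⟨ha, s, hs, h⟩ ⟨hb, t, ht, h'⟩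
    refine ⟨add_mem ha hb, s + t, add_nonneg hs ht, ?_⟩
    rw [add_smul, add_sub_add_comm]
    exact add_mem h h'
  smul_mem' := by
    rintro c a ⟨ha, s, hs, h⟩
    refine ⟨Submodule.smul_mem _ c ha, c * s, mul_nonneg c.2 hs, ?_⟩
    have := Submodule.smul_mem _ c h
    rw [smul_sub] at this
    rwa [mul_smul]

variable {K : PointedCone ℝ E} {y z w : E}

theorem minFace_le : minFace K y ≤ K := fun _ h => h.1

theorem self_mem_minFace (hy : y ∈ K) : y ∈ minFace K y := ⟨hy, 1, zero_le_one, by simp⟩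

/-- A multiple of y dominates each point of its face, so moving along y alone suffices. -/
theorem mem_tangent_minFace (hy : y ∈ K) :
    w ∈ tangent K (minFace K y) ↔ ∃ s : ℝ, 0 ≤ s ∧ w + s • y ∈ K := by
  constructor
  · rintro ⟨z, ⟨hz, s, hs, h⟩, hw⟩
    refine ⟨s, hs, ?_⟩
    convert add_mem hw h using 1
    abel
  · rintro ⟨s, hs, h⟩
    exact ⟨s • y, PointedCone.smul_mem _ hs (self_mem_minFace hy), h⟩

theorem le_tangent {G : PointedCone ℝ E} : K ≤ tangent K G := fun w hw =>
  ⟨0, zero_mem _, by simpa⟩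

theorem minFace_le_minFace (h : z ∈ minFace K y) : minFace K z ≤ minFace K y := by
  rintro w ⟨hw, s, hs, h'⟩
  obtain ⟨_, t, ht, h⟩ := h
  refine ⟨hw, s * t, mul_nonneg hs ht, ?_⟩
  convert add_mem h' (PointedCone.smul_mem _ hs h) using 1
  module

theorem minFace_eq_iff (hy : y ∈ K) (hz : z ∈ K) :
    minFace K y = minFace K z ↔ y ∈ minFace K z ∧ z ∈ minFace K y :=
  ⟨fun h => ⟨h ▸ self_mem_minFace hy, h ▸ self_mem_minFace hz⟩,
    fun h => le_antisymm (minFace_le_minFace h.1) (minFace_le_minFace h.2)⟩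

/-- The span of a face is the lineality space of its tangent cone. -/
theorem mem_span_minFace_iff (hy : y ∈ K) :
    w ∈ Submodule.span ℝ (minFace K y : Set E) ↔
      w ∈ tangent K (minFace K y) ∧ -w ∈ tangent K (minFace K y) := by
  constructor
  · intro hw
    induction hw using Submodule.span_induction with
    | mem x hx =>
      exact ⟨le_tangent (minFace_le hx), x, hx, by simp⟩
    | zero => simp
    | add a b _ _ ha hb => exact ⟨add_mem ha.1 hb.1, by rw [neg_add]; exact add_mem ha.2 hb.2⟩
    | smul c a _ ha =>
      rcases le_total 0 c with hc | hc
      · exact ⟨PointedCone.smul_mem _ hc ha.1, by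
          rw [← smul_neg]; exact PointedCone.smul_mem _ hc ha.2⟩
      · have hc' : 0 ≤ -c := neg_nonneg.2 hc
        exact ⟨by rw [← neg_smul_neg]; exact PointedCone.smul_mem _ hc' ha.2, by
          rw [← neg_smul]; exact PointedCone.smul_mem _ hc' ha.1⟩
  · rintro ⟨h1, h2⟩
    rw [mem_tangent_minFace hy] at h1 h2
    obtain ⟨s, hs, h1⟩ := h1
    obtain ⟨t, ht, h2⟩ := h2
    have : w + s • y ∈ minFace K y := by
      refine ⟨h1, s + t, add_nonneg hs ht, ?_⟩
      convert h2 using 1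
      module
    have h3 := Submodule.sub_mem _ (Submodule.subset_span this)
      (Submodule.smul_mem _ s (Submodule.subset_span (self_mem_minFace hy)))
    simpa using h3

theorem tangent_self : (tangent K K : Set E) = Submodule.span ℝ (K : Set E) := by
  ext w
  constructor
  · rintro ⟨z, hz, h⟩
    have := Submodule.sub_mem _ (Submodule.subset_span (R := ℝ) h) (Submodule.subset_span hz)
    simpa using this
  · intro hw
    induction hw using Submodule.span_induction with
    | mem x hx => exact le_tangent hx
    | zero => exact zero_mem _
    | add a b _ _ ha hb => exact add_mem ha hb
    | smul c a _ ha =>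
      rcases le_total 0 c with hc | hc
      · exact PointedCone.smul_mem _ hc ha
      · obtain ⟨z, hz, h⟩ := ha
        refine ⟨(-c) • (a + z), PointedCone.smul_mem _ (neg_nonneg.2 hc) h, ?_⟩
        rw [smul_add, neg_smul, add_neg_cancel_left]
        exact PointedCone.smul_mem _ (neg_nonneg.2 hc) hz

/-- The points of `K` whose smallest face is `G`: the relative interior of the face `G`. -/
def openFace (K G : PointedCone ℝ E) : Set E := {y | y ∈ K ∧ minFace K y = G}

theorem add_mem_openFace (hw : w ∈ minFace K y) (hy : y ∈ K) :
    y + w ∈ openFace K (minFace K y) := by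
  have h : y + w ∈ minFace K y := add_mem (self_mem_minFace hy) hw
  refine ⟨h.1, (minFace_eq_iff h.1 hy).2 ⟨h, hy, 1, zero_le_one, ?_⟩⟩
  simpa using hw.1

theorem vectorSpan_openFace (hy : y ∈ K) :
    vectorSpan ℝ (openFace K (minFace K y)) = Submodule.span ℝ (minFace K y : Set E) := by
  have hy' : y ∈ openFace K (minFace K y) := ⟨hy, rfl⟩
  apply le_antisymm
  · rw [vectorSpan_eq_span_vsub_set_right ℝ hy', Submodule.span_le]
    rintro _ ⟨z, ⟨hz, h⟩, rfl⟩
    exact Submodule.sub_mem _ (Submodule.subset_span (h ▸ self_mem_minFace hz))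
      (Submodule.subset_span (self_mem_minFace hy))
  · rw [Submodule.span_le]
    intro w hw
    simpa using vsub_mem_vectorSpan ℝ (add_mem_openFace hw hy) hy'

theorem smul_add_smul_mem_openFace {G : PointedCone ℝ E} (hy : y ∈ openFace K G)
    (hz : z ∈ openFace K G) {a b : ℝ} (ha : 0 ≤ a) (hb : 0 ≤ b) (hab : 0 < a + b) :
    a • y + b • z ∈ openFace K G := by
  obtain ⟨hy, rfl⟩ := hy
  obtain ⟨hz, h⟩ := hz
  have hzy : z ∈ minFace K y := h ▸ self_mem_minFace hz
  have hm : a • y + b • z ∈ minFace K y :=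
    add_mem (PointedCone.smul_mem _ ha (self_mem_minFace hy)) (PointedCone.smul_mem _ hb hzy)
  refine ⟨hm.1, (minFace_eq_iff hm.1 hy).2 ⟨hm, ?_⟩⟩
  rcases ha.eq_or_lt with rfl | ha
  · rw [zero_add] at hab
    rw [zero_smul, zero_add]
    have hyz : y ∈ minFace K z := h ▸ self_mem_minFace hy
    obtain ⟨_, s, hs, h'⟩ := hyz
    refine ⟨hy, s / b, by positivity, ?_⟩
    rwa [smul_smul, div_mul_cancel₀ _ hab.ne']
  · refine ⟨hy, 1 / a, by positivity, ?_⟩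
    have : (1 / a) • (a • y + b • z) - y = (b / a) • z := by
      rw [smul_add, smul_smul, smul_smul, one_div_mul_cancel ha.ne', one_smul, add_sub_cancel_left]
      congr 1
      ring
    rw [this]
    exact PointedCone.smul_mem _ (by positivity) hz

theorem segOpen_openFace (G : PointedCone ℝ E) : SegOpen (openFace K G) := by
  refine ⟨fun y hy z hz a b ha hb hab =>
    smul_add_smul_mem_openFace hy hz ha hb (by rw [hab]; exact one_pos), fun y hy z hz => ?_⟩
  obtain ⟨hy, rfl⟩ := hy
  obtain ⟨hz, h⟩ := hz
  have hyz : y ∈ minFace K z := h ▸ self_mem_minFace hy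
  obtain ⟨_, s, hs, h'⟩ := hyz
  -- Chosen so that z + ε(z - y) = ε(s z - y) + 2ε z, a sum of two elements of K.
  refine ⟨1 / (s + 1), by positivity, ?_⟩
  have hε : 1 / (s + 1) ≤ 1 := by rw [div_le_one (by positivity)]; linarith
  have h1 : z + (1 / (s + 1)) • (z - y) = (1 / (s + 1)) • (s • z - y) + (2 / (s + 1)) • z := by
    have : 1 / (s + 1) * s = 1 - 1 / (s + 1) := by field_simp; ring
    rw [smul_sub _ (s • z), smul_smul, this, div_eq_mul_one_div 2]
    module
  have hmem : z + (1 / (s + 1)) • (z - y) ∈ K := by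
    rw [h1]
    exact add_mem (PointedCone.smul_mem _ (by positivity) h')
      (PointedCone.smul_mem _ (by positivity) hz)
  refine ⟨hmem, ?_⟩
  rw [← h]
  refine (minFace_eq_iff hmem hz).2 ⟨⟨hmem, 2, by norm_num, ?_⟩, hz, (s + 1) / 2, by positivity, ?_⟩
  · have : (2 : ℝ) • z - (z + (1 / (s + 1)) • (z - y)) =
        (1 - 1 / (s + 1)) • z + (1 / (s + 1)) • y := by module
    rw [this]
    exact add_mem (PointedCone.smul_mem _ (by linarith) hz)
      (PointedCone.smul_mem _ (by positivity) hy)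
  · rw [h1, smul_add, smul_smul, smul_smul]
    have e1 : (s + 1) / 2 * (2 / (s + 1)) = 1 := by field_simp
    rw [e1, one_smul, add_sub_cancel_right]
    exact PointedCone.smul_mem _ (by positivity) h'

/-- The faces of a cone. -/
def faces (K : PointedCone ℝ E) : Set (PointedCone ℝ E) := {G | ∃ y ∈ K, minFace K y = G}

/-- A face is determined by the generators in it: those with positive coefficient in y already lie
in the face of y. -/
theorem finite_faces (hK : K.FG) : (faces K).Finite := by
  obtain ⟨k, u, rfl⟩ := exists_fin_of_fg hK
  refine Set.Finite.of_finite_image (f := fun G => {i | u i ∈ G}) (Set.toFinite _) ?_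
  have key : ∀ y ∈ PointedCone.hull ℝ (Set.range u), ∀ z,
      {i | u i ∈ minFace (PointedCone.hull ℝ (Set.range u)) y} ⊆
      {i | u i ∈ minFace (PointedCone.hull ℝ (Set.range u)) z} →
      y ∈ minFace (PointedCone.hull ℝ (Set.range u)) z := by
    intro y hy z h
    obtain ⟨α, hα, hyα⟩ := mem_hull_range_iff.1 hy
    have hu : ∀ i, u i ∈ PointedCone.hull ℝ (Set.range u) := fun i => Submodule.subset_span ⟨i, rfl⟩
    rw [hyα]
    refine Submodule.sum_mem _ fun i _ => ?_
    rcases (hα i).eq_or_lt with h0 | hi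
    · rw [← h0, zero_smul]
      exact zero_mem _
    · refine PointedCone.smul_mem _ hi.le (h ⟨hu i, 1 / α i, by positivity, ?_⟩)
      rw [hyα, ← Finset.add_sum_erase _ _ (Finset.mem_univ i), smul_add, smul_smul,
        one_div_mul_cancel hi.ne', one_smul, add_sub_cancel_left]
      exact PointedCone.smul_mem _ (by positivity)
        (Submodule.sum_mem _ fun j _ => PointedCone.smul_mem _ (hα j) (hu j))
  rintro _ ⟨y, hy, rfl⟩ _ ⟨z, hz, rfl⟩ h
  exact (minFace_eq_iff hy hz).2 ⟨key y hy z h.subset, key z hz y h.symm.subset⟩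

/-- The sum of the generators dominates each of them, so it is a relative interior point. -/
theorem exists_minFace_eq (hK : K.FG) : ∃ a ∈ K, minFace K a = K := by
  obtain ⟨k, u, rfl⟩ := exists_fin_of_fg hK
  have hu : ∀ i, u i ∈ PointedCone.hull ℝ (Set.range u) := fun i => Submodule.subset_span ⟨i, rfl⟩
  have ha : ∑ i, u i ∈ PointedCone.hull ℝ (Set.range u) := Submodule.sum_mem _ fun i _ => hu i
  refine ⟨∑ i, u i, ha, le_antisymm minFace_le ?_⟩
  rw [PointedCone.hull, Submodule.span_le]
  rintro _ ⟨i, rfl⟩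
  refine ⟨hu i, 1, zero_le_one, ?_⟩
  rw [one_smul, ← Finset.add_sum_erase _ _ (Finset.mem_univ i), add_sub_cancel_left]
  exact Submodule.sum_mem _ fun j _ => hu j

theorem tangent_minFace (hy : y ∈ K) : tangent K (minFace K y) = K ⊔ PointedCone.hull ℝ {-y} := by
  apply le_antisymm
  · intro w hw
    obtain ⟨s, hs, h⟩ := (mem_tangent_minFace hy).1 hw
    rw [Submodule.mem_sup]
    refine ⟨_, h, s • -y, PointedCone.smul_mem _ hs (Submodule.subset_span rfl), ?_⟩
    module
  · refine sup_le le_tangent ?_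
    rw [PointedCone.hull, Submodule.span_le, Set.singleton_subset_iff]
    exact ⟨y, self_mem_minFace hy, by simp⟩

theorem fg_tangent (hK : K.FG) {G : PointedCone ℝ E} (hG : G ∈ faces K) :
    (tangent K G).FG := by
  obtain ⟨y, hy, rfl⟩ := hG
  rw [tangent_minFace hy]
  exact hK.sup ⟨{-y}, by simp⟩

end Cone
end RatCone

namespace RatCone

open Filter Topology Module

/-! ### Rays from open faces in a generic direction. -/

section Tangent

variable {E : Type*}

theorem SegOpen.prod [AddCommGroup E] [Module ℝ E] {F : Type*} [AddCommGroup F] [Module ℝ F]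
    {U : Set E} {V : Set F} (hU : SegOpen U) (hV : SegOpen V) : SegOpen (U ×ˢ V) := by
  refine ⟨hU.1.prod hV.1, fun y hy z hz => ?_⟩
  obtain ⟨ε, hε, h⟩ := hU.exists_forall_le hy.1 hz.1
  obtain ⟨δ, hδ, h'⟩ := hV.exists_forall_le hy.2 hz.2
  exact ⟨min ε δ, lt_min hε hδ, h _ (lt_min hε hδ).le (min_le_left _ _),
    h' _ (lt_min hε hδ).le (min_le_right _ _)⟩

theorem segOpen_Ioi : SegOpen (Set.Ioi (0 : ℝ)) := by
  refine ⟨convex_Ioi 0, fun y hy z hz => ⟨z / (z + y), ?_, ?_⟩⟩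
  · have hy : 0 < y := hy
    have hz : 0 < z := hz
    positivity
  · have hy : 0 < y := hy
    have hz : 0 < z := hz
    have : z + (z / (z + y)) • (z - y) = 2 * z ^ 2 / (z + y) := by
      rw [smul_eq_mul]
      field_simp
      ring
    rw [Set.mem_Ioi, this]
    positivity

/-- The union of the open rays in direction `x` that start in `U`. -/
def rays [AddCommGroup E] [Module ℝ E] (U : Set E) (x : E) : Set E :=
  {z | ∃ t : ℝ, 0 < t ∧ z - t • x ∈ U}

theorem SegOpen.rays [AddCommGroup E] [Module ℝ E] {U : Set E} (hU : SegOpen U) (x : E) :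
    SegOpen (rays U x) := by
  have h := (hU.prod segOpen_Ioi).image
    (LinearMap.fst ℝ E ℝ + (LinearMap.snd ℝ E ℝ).smulRight x)
  convert h using 1
  ext z
  constructor
  · rintro ⟨t, ht, h⟩
    exact ⟨(z - t • x, t), ⟨h, ht⟩, by simp⟩
  · rintro ⟨⟨b, t⟩, ⟨h, ht⟩, rfl⟩
    exact ⟨t, ht, by simpa using h⟩

variable [AddCommGroup E] [Module ℝ E] {K G : PointedCone ℝ E} {x y z b : E}

/-- From an inner point of a segment in K one can move both ways along x, so x is in the lineality
space of the tangent cone there. -/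
theorem mem_span_minFace_of_mem_segment {ε δ : ℝ} (hb : b ∈ K) (hbε : b + ε • x ∈ K) (hδ : 0 < δ)
    (hδε : δ < ε) : b + δ • x ∈ K ∧ x ∈ Submodule.span ℝ (minFace K (b + δ • x) : Set E) := by
  have hε : 0 < ε := hδ.trans hδε
  have e : b + δ • x = (1 - δ / ε) • b + (δ / ε) • (b + ε • x) := by
    rw [smul_add, smul_smul, div_mul_cancel₀ _ hε.ne']
    module
  have h1 : 0 ≤ 1 - δ / ε := by
    rw [sub_nonneg, div_le_one hε]
    exact hδε.le
  have hm : b + δ • x ∈ K := by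
    rw [e]
    exact add_mem (PointedCone.smul_mem _ h1 hb)
      (PointedCone.smul_mem _ (by positivity) hbε)
  refine ⟨hm, (mem_span_minFace_iff hm).2 ⟨?_, ?_⟩⟩
  · rw [mem_tangent_minFace hm]
    refine ⟨1 / (ε - δ), (one_div_pos.2 (sub_pos.2 hδε)).le, ?_⟩
    have := PointedCone.smul_mem _ (one_div_pos.2 (sub_pos.2 hδε)).le hbε
    convert this using 1
    have h2 : 1 / (ε - δ) * ε = 1 + 1 / (ε - δ) * δ := by
      field_simp [(sub_pos.2 hδε).ne']
      ring
    rw [smul_add, smul_add, smul_smul, smul_smul, h2]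
    module
  · rw [mem_tangent_minFace hm]
    refine ⟨1 / δ, by positivity, ?_⟩
    have := PointedCone.smul_mem _ (one_div_pos.2 hδ).le hb
    convert this using 1
    rw [smul_add, smul_smul, one_div_mul_cancel hδ.ne']
    module

theorem exists_add_smul_mem_of_mem_tangent (hb : b ∈ K) (hx : x ∈ tangent K (minFace K b)) :
    ∃ ε : ℝ, 0 < ε ∧ b + ε • x ∈ K := by
  obtain ⟨s, hs, h⟩ := (mem_tangent_minFace hb).1 hx
  refine ⟨1 / (s + 1), by positivity, ?_⟩
  have := PointedCone.smul_mem _ (show 0 ≤ 1 / (s + 1) by positivity) (add_mem h hb)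
  convert this using 1
  have h2 : (1 : ℝ) = 1 / (s + 1) * s + 1 / (s + 1) := by field_simp
  nth_rewrite 1 [← one_smul ℝ b, h2]
  module

theorem mem_tangent_of_add_smul_mem (hb : b ∈ K) {ε : ℝ} (hε : 0 < ε) (h : b + ε • x ∈ K) :
    x ∈ tangent K (minFace K b) := by
  rw [mem_tangent_minFace hb]
  refine ⟨1 / ε, by positivity, ?_⟩
  have := PointedCone.smul_mem _ (show 0 ≤ 1 / ε by positivity) h
  convert this using 1
  rw [smul_add, smul_smul, one_div_mul_cancel hε.ne']
  module

/-- `x` does not lie in the span of a proper face of `K`. -/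
def GenericDir (K : PointedCone ℝ E) (x : E) : Prop :=
  ∀ y ∈ K, x ∈ Submodule.span ℝ (minFace K y : Set E) → minFace K y = K

/-- The points just after y have x in the span of their face; by genericity that face is K. -/
theorem GenericDir.exists_mem_rays (hx : GenericDir K x) (hG : y ∈ openFace K G)
    (hxG : x ∈ tangent K G) :
    ∃ ε : ℝ, 0 < ε ∧ ∀ δ, 0 < δ → δ < ε → y + δ • x ∈ rays (openFace K G) x ∩ openFace K K := by
  obtain ⟨hy, rfl⟩ := hG
  obtain ⟨ε, hε, h⟩ := exists_add_smul_mem_of_mem_tangent hy hxG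
  refine ⟨ε, hε, fun δ hδ hδε => ⟨⟨δ, hδ, by simpa using ⟨hy, rfl⟩⟩, ?_⟩⟩
  obtain ⟨h1, h2⟩ := mem_span_minFace_of_mem_segment hy h hδ hδε
  exact ⟨h1, hx _ h1 h2⟩

/-- Genericity makes x transversal to the span of the proper face. Cutting with the interior of K
loses no dimension, because the rays start inside it. -/
theorem GenericDir.finrank_rays [FiniteDimensional ℝ E] (hx : GenericDir K x)
    (hy : y ∈ K) (hne : minFace K y ≠ K) (hxG : x ∈ tangent K (minFace K y)) :
    finrank ℝ (vectorSpan ℝ (rays (openFace K (minFace K y)) x ∩ openFace K K)) =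
      finrank ℝ (Submodule.span ℝ (minFace K y : Set E)) + 1 := by
  have hxs : x ∉ Submodule.span ℝ (minFace K y : Set E) := fun h => hne (hx y hy h)
  have hx0 : x ≠ 0 := by
    rintro rfl
    exact hxs (zero_mem _)
  have hyo : y ∈ openFace K (minFace K y) := ⟨hy, rfl⟩
  have e : vectorSpan ℝ (rays (openFace K (minFace K y)) x ∩ openFace K K) =
      Submodule.span ℝ (minFace K y : Set E) ⊔ Submodule.span ℝ {x} := by
    apply le_antisymm
    · rw [← vectorSpan_openFace hy, vectorSpan_def, Submodule.span_le]
      rintro _ ⟨p, ⟨⟨s, _, hp⟩, _⟩, q, ⟨⟨t, _, hq⟩, _⟩, rfl⟩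
      have h1 := vsub_mem_vectorSpan ℝ hp hq
      have h2 : (s - t) • x ∈ Submodule.span ℝ {x} :=
        Submodule.smul_mem _ _ (Submodule.mem_span_singleton_self x)
      have := add_mem (Submodule.mem_sup_left h1) (Submodule.mem_sup_right h2)
      have e : p - s • x -ᵥ (q - t • x) + (s - t) • x = p -ᵥ q := by
        simp only [vsub_eq_sub]
        module
      rwa [e] at this
    · refine sup_le ?_ ?_
      · rw [← vectorSpan_openFace hy, vectorSpan_def, Submodule.span_le]
        rintro _ ⟨p, hp, q, hq, rfl⟩
        obtain ⟨ε, hε, h⟩ := hx.exists_mem_rays hp hxG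
        obtain ⟨δ, hδ, h'⟩ := hx.exists_mem_rays hq hxG
        have hm : 0 < min ε δ / 2 := half_pos (lt_min hε hδ)
        have hm' : min ε δ / 2 < min ε δ := half_lt_self (lt_min hε hδ)
        have := vsub_mem_vectorSpan ℝ (h _ hm (hm'.trans_le (min_le_left _ _)))
          (h' _ hm (hm'.trans_le (min_le_right _ _)))
        simpa using this
      · rw [Submodule.span_le, Set.singleton_subset_iff]
        obtain ⟨ε, hε, h⟩ := hx.exists_mem_rays hyo hxG
        have := vsub_mem_vectorSpan ℝ (h (ε / 2) (by linarith) (by linarith))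
          (h (ε / 4) (by linarith) (by linarith))
        have h2 : (y + (ε / 2) • x) -ᵥ (y + (ε / 4) • x) = (ε / 4) • x := by
          rw [vsub_eq_sub]
          module
        rw [h2] at this
        exact (Submodule.smul_mem_iff _ (by positivity : ε / 4 ≠ 0)).1 this
  rw [e]
  have h1 := Submodule.finrank_sup_add_finrank_inf_eq
    (Submodule.span ℝ (minFace K y : Set E)) (Submodule.span ℝ {x})
  have h2 : Submodule.span ℝ (minFace K y : Set E) ⊓ Submodule.span ℝ {x} = ⊥ := by
    rw [← disjoint_iff, Submodule.disjoint_span_singleton' hx0]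
    exact hxs
  rw [h2, finrank_bot, finrank_span_singleton hx0] at h1
  omega

end Tangent

/-! ### The alternating sum over tangent cones. -/

section Sum

variable {E : Type*} [NormedAddCommGroup E] [NormedSpace ℝ E] [FiniteDimensional ℝ E]
  {K : PointedCone ℝ E} {x : E}

/-- From a point of `K` go as far as possible inside `K` in direction `-x`. -/
theorem exists_max_sub_smul_mem (hK : K.FG) (hx : -x ∉ K) {z : E} (hz : z ∈ K) :
    ∃ t : ℝ, 0 ≤ t ∧ z - t • x ∈ K ∧ ∀ s, z - s • x ∈ K → s ≤ t := by
  obtain ⟨l, hl, hlx⟩ := exists_separating_of_fg hK hx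
  -- With l ≤ 0 on K and l(-x) > 0, the inequality l(z - t x) ≤ 0 bounds t.
  have hb : BddAbove {t : ℝ | z - t • x ∈ K} := by
    refine ⟨-l z / l (-x), fun t ht => ?_⟩
    have := hl _ ht
    rw [le_div_iff₀ hlx]
    simp only [map_sub, map_smul, smul_eq_mul, map_neg] at this ⊢
    linarith
  have hne : (0 : ℝ) ∈ {t : ℝ | z - t • x ∈ K} := by simpa using hz
  have hc : IsClosed {t : ℝ | z - t • x ∈ K} :=
    (isClosed_of_fg hK).preimage (f := fun t : ℝ => z - t • x) (by fun_prop)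
  exact ⟨sSup {t : ℝ | z - t • x ∈ K}, le_csSup hb hne, hc.csSup_mem ⟨0, hne⟩ hb,
    fun s hs => le_csSup hb hs⟩

/-- G is the face through which the backward ray from z leaves K. Earlier points of that ray are
inner points of a segment along x, hence in the relative interior by genericity. -/
theorem exists_unique_mem_rays (hK : K.FG) (hx : GenericDir K x) (hnx : -x ∉ K)
    (hxs : x ∈ Submodule.span ℝ (K : Set E)) {z : E} (hz : z ∈ openFace K K) :
    ∃ G ∈ faces K, G ≠ K ∧ x ∈ tangent K G ∧ z ∈ rays (openFace K G) x ∧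
      ∀ G', G' ≠ K → z ∈ rays (openFace K G') x → G' = G := by
  obtain ⟨t, ht, hm, hmax⟩ := exists_max_sub_smul_mem hK hnx hz.1
  have hneg : ∀ w, w ∈ openFace K K → ∃ ε : ℝ, 0 < ε ∧ w - ε • x ∈ K := by
    rintro w ⟨hw, h⟩
    have : -x ∈ tangent K (minFace K w) := by
      rw [h, ← SetLike.mem_coe, tangent_self]
      exact neg_mem hxs
    obtain ⟨ε, hε, h⟩ := exists_add_smul_mem_of_mem_tangent hw this
    exact ⟨ε, hε, by simpa [sub_eq_add_neg] using h⟩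
  have ht0 : 0 < t := by
    obtain ⟨ε, hε, h⟩ := hneg z hz
    exact hε.trans_le (hmax _ h)
  refine ⟨minFace K (z - t • x), ⟨_, hm, rfl⟩, fun h => ?_, ?_, ⟨t, ht0, hm, rfl⟩, ?_⟩
  · obtain ⟨ε, hε, h⟩ := hneg _ ⟨hm, h⟩
    rw [sub_sub, ← add_smul] at h
    linarith [hmax _ h]
  · exact mem_tangent_of_add_smul_mem hm ht0 (by simpa using hz.1)
  · rintro G' hG' ⟨s, hs, hsK, rfl⟩
    rcases (hmax s hsK).eq_or_lt with rfl | hst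
    · rfl
    · exfalso
      have h1 : (z - t • x) + t • x ∈ K := by simpa using hz.1
      have h2 := mem_span_minFace_of_mem_segment hm h1 (sub_pos.2 hst) (by linarith : t - s < t)
      have e : z - t • x + (t - s) • x = z - s • x := by module
      rw [e] at h2
      exact hG' (hx _ h2.1 h2.2)

open Classical in
theorem sum_tangent_of_genericDir (hK : K.FG) (hx : GenericDir K x) (hnx : -x ∉ K) :
    ∑ G ∈ (finite_faces hK).toFinset, (-1 : ℤ) ^ finrank ℝ (Submodule.span ℝ (G : Set E)) *
      (if x ∈ tangent K G then 1 else 0) = 0 := by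
  by_cases hxs : x ∈ Submodule.span ℝ (K : Set E)
  · have hmem : ∀ G, G ∈ (finite_faces hK).toFinset ↔ G ∈ faces K := by simp
    -- The interior of K counts +1 and its disjoint pieces -1. A piece has dimension dim G + 1,
    -- which turns its sign back into (-1)^dim G.
    let U : PointedCone ℝ E → Set E := fun G =>
      if G = K then openFace K K else rays (openFace K G) x ∩ openFace K K
    have hKt : x ∈ tangent K K := by rwa [← SetLike.mem_coe, tangent_self]
    have hsum := sum_euler_eq_zero (s := (finite_faces hK).toFinset.filter fun G => x ∈ tangent K G)
      (c := fun G => if G = K then 1 else -1) (U := U) ?_ ?_ ?_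
    · rw [Finset.sum_filter] at hsum
      refine Eq.trans (Finset.sum_congr rfl fun G hG => ?_) hsum
      obtain ⟨y, hy, rfl⟩ := (hmem G).1 hG
      split_ifs with h1 h2
      · have hU : U (minFace K y) = openFace K (minFace K y) := (if_pos h2).trans (by rw [h2])
        rw [hU, vectorSpan_openFace hy, mul_one, one_mul]
      · have hU : U (minFace K y) = rays (openFace K (minFace K y)) x ∩ openFace K K := if_neg h2
        rw [hU, hx.finrank_rays hy h2 h1, pow_succ]
        ring
      · simp
    · intro G _
      simp only [U]
      split_ifs
      · exact segOpen_openFace K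
      · exact ((segOpen_openFace G).rays x).inter (segOpen_openFace K)
    · intro G hG
      obtain ⟨hG, hxG⟩ := Finset.mem_filter.1 hG
      obtain ⟨y, hy, rfl⟩ := (hmem G).1 hG
      simp only [U]
      split_ifs with h
      · exact ⟨y, hy, h⟩
      · obtain ⟨ε, hε, h⟩ := hx.exists_mem_rays ⟨hy, rfl⟩ hxG
        exact ⟨_, h (ε / 2) (by linarith) (by linarith)⟩
    · intro z
      by_cases hz : z ∈ openFace K K
      · obtain ⟨G, hG, hGK, hxG, hzG, huniq⟩ := exists_unique_mem_rays hK hx hnx hxs hz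
        rw [Finset.sum_eq_add_of_mem K G _ _ hGK.symm]
        · simp [U, hz, hGK, hzG]
        · intro G' _ hG'
          by_cases hzG' : z ∈ rays (openFace K G') x
          · exact absurd (huniq G' hG'.1 hzG') hG'.2
          · simp [U, hG'.1, hzG']
        · simp only [Finset.mem_filter, hmem]
          exact ⟨exists_minFace_eq hK, hKt⟩
        · simp only [Finset.mem_filter, hmem]
          exact ⟨hG, hxG⟩
      · refine Finset.sum_eq_zero fun G _ => ?_
        have : z ∉ U G := by
          simp only [U]
          split_ifs
          · exact hz
          · exact fun h => hz h.2
        simp [this]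
  · refine Finset.sum_eq_zero fun G hG => ?_
    rw [if_neg, mul_zero]
    obtain ⟨y, hy, rfl⟩ := (finite_faces hK).mem_toFinset.1 hG
    rintro ⟨w, hw, h⟩
    apply hxs
    have := Submodule.sub_mem _ (Submodule.subset_span (R := ℝ) h)
      (Submodule.subset_span (minFace_le hw))
    simpa using this

open Classical in
/-- The alternating sum of the indicator functions of the tangent cones of `K` vanishes
outside the reflection of the relative interior of `K`. -/
theorem sum_tangent_eq_zero (hK : K.FG) (hx : -x ∉ openFace K K) :
    ∑ G ∈ (finite_faces hK).toFinset, (-1 : ℤ) ^ finrank ℝ (Submodule.span ℝ (G : Set E)) *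
      (if x ∈ tangent K G then 1 else 0) = 0 := by
  obtain ⟨a, ha, haK⟩ := exists_minFace_eq hK
  have hev : ∀ {S : Set E}, IsClosed S → x ∉ S → ∀ᶠ ε : ℝ in 𝓝[>] 0, x + ε • a ∉ S := by
    intro S hS hxS
    have hcont : Continuous fun ε : ℝ => x + ε • a := by fun_prop
    have : ∀ᶠ ε : ℝ in 𝓝 0, x + ε • a ∈ Sᶜ :=
      hcont.continuousAt.eventually_mem (by simpa using hS.isOpen_compl.mem_nhds hxS)
    exact this.filter_mono nhdsWithin_le_nhds
  have h1 : ∀ᶠ ε : ℝ in 𝓝[>] 0, ∀ G ∈ (finite_faces hK).toFinset,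
      x ∉ tangent K G → x + ε • a ∉ tangent K G := by
    rw [Finset.eventually_all]
    intro G hG
    by_cases h : x ∈ tangent K G
    · simp [h]
    · exact (hev (isClosed_of_fg (fg_tangent hK
        ((finite_faces hK).mem_toFinset.1 hG))) h).mono fun _ h _ => h
  have h2 : ∀ᶠ ε : ℝ in 𝓝[>] 0, ∀ G ∈ (finite_faces hK).toFinset,
      x ∉ Submodule.span ℝ (G : Set E) → x + ε • a ∉ Submodule.span ℝ (G : Set E) := by
    rw [Finset.eventually_all]
    intro G hG
    by_cases h : x ∈ Submodule.span ℝ (G : Set E)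
    · simp [h]
    · exact (hev (Submodule.closed_of_finiteDimensional _) h).mono fun _ h _ => h
  obtain ⟨ε, ⟨h1, h2⟩, hε⟩ := ((h1.and h2).and self_mem_nhdsWithin).exists
  have hε : 0 < ε := hε
  -- If x + εa is in the span of a face, then by the choice of ε so is x, hence a, and a face whose
  -- span contains the interior point a is K.
  have hgen : GenericDir K (x + ε • a) := by
    intro y hy h
    have hyf : minFace K y ∈ (finite_faces hK).toFinset := by simpa using ⟨y, hy, rfl⟩
    have hxs : x ∈ Submodule.span ℝ (minFace K y : Set E) := by
      by_contra hc
      exact h2 _ hyf hc h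
    have has : a ∈ Submodule.span ℝ (minFace K y : Set E) := by
      have := Submodule.sub_mem _ h hxs
      rw [add_sub_cancel_left] at this
      exact (Submodule.smul_mem_iff _ hε.ne').1 this
    have hat := ((mem_span_minFace_iff hy).1 has).2
    obtain ⟨s, hs, h'⟩ := (mem_tangent_minFace hy).1 hat
    refine le_antisymm minFace_le ?_
    have : a ∈ minFace K y := ⟨ha, s, hs, by rwa [neg_add_eq_sub] at h'⟩
    calc K = minFace K a := haK.symm
      _ ≤ _ := minFace_le_minFace this
  -- Otherwise -x is a point of K plus εa, hence in the relative interior.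
  have hnx : -(x + ε • a) ∉ K := by
    intro h
    have hxK : -x ∈ K := by
      have := add_mem h (PointedCone.smul_mem _ hε.le ha)
      simpa using this
    apply hx
    refine ⟨hxK, le_antisymm minFace_le ?_⟩
    have : a ∈ minFace K (-x) := by
      refine ⟨ha, 1 / ε, by positivity, ?_⟩
      have := PointedCone.smul_mem _ (show 0 ≤ 1 / ε by positivity) h
      convert this using 1
      rw [neg_add, smul_add, smul_neg (1 / ε) (ε • a), smul_smul, one_div_mul_cancel hε.ne',
        one_smul, sub_eq_add_neg]
    calc K = minFace K a := haK.symm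
      _ ≤ _ := minFace_le_minFace this
  refine Eq.trans (Finset.sum_congr rfl fun G hG => ?_) (sum_tangent_of_genericDir hK hgen hnx)
  congr 1
  have : x ∈ tangent K G ↔ x + ε • a ∈ tangent K G :=
    ⟨fun h => add_mem h (PointedCone.smul_mem _ hε.le (le_tangent ha)),
      fun h => by
        by_contra hc
        exact h1 G hG hc h⟩
  simp only [this]

end Sum
end RatCone

namespace RatCone

open scoped Pointwise

/-! ### Finite unions of translates of finitely generated monoids. -/

section FinGen

variable {G : Type*} [AddCommGroup G]

/-- Dickson's lemma: the minimal elements of Q form an antichain. -/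
theorem exists_finite_forall_exists_le {α : Type*} [PartialOrder α] [WellQuasiOrderedLE α]
    (Q : Set α) : ∃ A : Set α, A.Finite ∧ A ⊆ Q ∧ ∀ q ∈ Q, ∃ a ∈ A, a ≤ q := by
  have hpwo := Set.isPWO_of_wellQuasiOrderedLE Q
  refine ⟨{a | Minimal (· ∈ Q) a}, (setOfPred_minimal_antichain _).finite_of_partiallyWellOrderedOn
    (hpwo.mono (setOfPred_minimal_subset _)), setOfPred_minimal_subset _, fun q hq => ?_⟩
  obtain ⟨b, hb, hbm⟩ := hpwo.exists_le_minimal hq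
  exact ⟨b, hbm, hb⟩

/-- `T` is a finite union of translates of the monoid `M`. -/
def FinGen (M : AddSubmonoid G) (T : Set G) : Prop := ∃ F : Set G, F.Finite ∧ T = F + (M : Set G)

/-- A Noetherian property: parametrise M by ℕⁿ; for each translate, the minimal exponents landing in
N give the generators. -/
theorem FinGen.of_subset {M : AddSubmonoid G} (hM : M.FG) {T N : Set G} (hT : FinGen M T)
    (hN : N ⊆ T) (hadd : ∀ x ∈ N, ∀ y ∈ M, x + y ∈ N) : FinGen M N := by
  obtain ⟨F, hF, rfl⟩ := hT
  obtain ⟨n, φ, rfl⟩ := AddSubmonoid.fg_iff_exists_fin_addMonoidHom.1 hM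
  choose A hAf hAQ hA using fun f : G => exists_finite_forall_exists_le {k | f + φ k ∈ N}
  refine ⟨⋃ f ∈ F, (fun k => f + φ k) '' A f, hF.biUnion fun f _ => (hAf f).image _, ?_⟩
  ext x
  constructor
  · intro hx
    obtain ⟨f, hf, _, ⟨k, rfl⟩, rfl⟩ := hN hx
    obtain ⟨a, ha, hak⟩ := hA f k hx
    refine ⟨f + φ a, Set.mem_biUnion hf ⟨a, ha, rfl⟩, φ (k - a), ⟨_, rfl⟩, ?_⟩
    simp only
    rw [add_assoc, ← map_add, add_tsub_cancel_of_le hak]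
  · rintro ⟨_, hy, z, hz, rfl⟩
    simp only [Set.mem_iUnion] at hy
    obtain ⟨f, hf, a, ha, rfl⟩ := hy
    exact hadd _ (hAQ f ha) _ hz

/-- The intersection is an image of the solution monoid of φ k = ψ l, which is finitely generated.
-/
theorem fg_inf {M₁ M₂ : AddSubmonoid G} (h₁ : M₁.FG) (h₂ : M₂.FG) : (M₁ ⊓ M₂).FG := by
  obtain ⟨a, φ, rfl⟩ := AddSubmonoid.fg_iff_exists_fin_addMonoidHom.1 h₁
  obtain ⟨b, ψ, rfl⟩ := AddSubmonoid.fg_iff_exists_fin_addMonoidHom.1 h₂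
  have h := (AddSubmonoid.fg_eqLocusM (φ.comp (AddMonoidHom.fst (Fin a → ℕ) (Fin b → ℕ)))
    (ψ.comp (AddMonoidHom.snd (Fin a → ℕ) (Fin b → ℕ)))).map
    (φ.comp (AddMonoidHom.fst (Fin a → ℕ) (Fin b → ℕ)))
  convert h using 1
  ext x
  constructor
  · rintro ⟨⟨k, rfl⟩, l, hl⟩
    exact ⟨(k, l), hl.symm, rfl⟩
  · rintro ⟨⟨k, l⟩, h, rfl⟩
    exact ⟨⟨k, rfl⟩, l, h.symm⟩

/-- The minimal solutions of f + φ k = f' + ψ l give the translates; a solution minus a minimal one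
below it solves the homogeneous equation. -/
theorem FinGen.inter {M₁ M₂ : AddSubmonoid G} (h₁ : M₁.FG) (h₂ : M₂.FG) {T₁ T₂ : Set G}
    (hT₁ : FinGen M₁ T₁) (hT₂ : FinGen M₂ T₂) : FinGen (M₁ ⊓ M₂) (T₁ ∩ T₂) := by
  obtain ⟨a, φ, rfl⟩ := AddSubmonoid.fg_iff_exists_fin_addMonoidHom.1 h₁
  obtain ⟨b, ψ, rfl⟩ := AddSubmonoid.fg_iff_exists_fin_addMonoidHom.1 h₂
  obtain ⟨F₁, hF₁, rfl⟩ := hT₁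
  obtain ⟨F₂, hF₂, rfl⟩ := hT₂
  choose A hAf hAQ hA using fun f : G × G =>
    exists_finite_forall_exists_le {k : (Fin a → ℕ) × (Fin b → ℕ) | f.1 + φ k.1 = f.2 + ψ k.2}
  refine ⟨⋃ f ∈ F₁ ×ˢ F₂, (fun k => f.1 + φ k.1) '' A f,
    (hF₁.prod hF₂).biUnion fun f _ => (hAf f).image _, ?_⟩
  ext x
  constructor
  · rintro ⟨⟨f, hf, _, ⟨k, rfl⟩, rfl⟩, f', hf', _, ⟨l, rfl⟩, h⟩
    obtain ⟨q, hq, hqk⟩ := hA (f, f') (k, l) h.symm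
    have e1 : φ k = φ q.1 + φ (k - q.1) := by rw [← map_add, add_tsub_cancel_of_le hqk.1]
    have e2 : ψ l = ψ q.2 + ψ (l - q.2) := by rw [← map_add, add_tsub_cancel_of_le hqk.2]
    refine ⟨f + φ q.1, Set.mem_biUnion (Set.mk_mem_prod hf hf') ⟨q, hq, rfl⟩, φ (k - q.1),
      ⟨⟨_, rfl⟩, l - q.2, ?_⟩, ?_⟩
    · have h1 : f + φ q.1 = f' + ψ q.2 := hAQ _ hq
      have h2 : f' + ψ l = f + φ k := h
      rw [e1, e2, ← add_assoc, ← add_assoc, h1] at h2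
      exact add_left_cancel h2
    · simp only
      rw [add_assoc, ← e1]
  · rintro ⟨_, hy, z, ⟨⟨k, hk⟩, l, hl⟩, rfl⟩
    simp only [Set.mem_iUnion] at hy
    obtain ⟨f, hf, q, hq, rfl⟩ := hy
    refine ⟨⟨f.1, hf.1, φ (q.1 + k), ⟨_, rfl⟩, ?_⟩, f.2, hf.2, ψ (q.2 + l), ⟨_, rfl⟩, ?_⟩
    · simp only [map_add, hk, add_assoc]
    · have h1 : f.1 + φ q.1 = f.2 + ψ q.2 := hAQ _ hq
      simp only [map_add, hl, h1, add_assoc]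

end FinGen

/-! ### Laurent series that represent rational functions. -/

section Series

variable {m : ℕ}

/-- `r` is the rational function represented by the Laurent series `f`. -/
def SeriesRep (f : LaurentSer m) (r : RatFunField m) : Prop :=
  ∃ θ p : LaurentPoly m, θ ≠ 0 ∧ polyMul θ f = ⇑p.coeff ∧
    r = algebraMap (LaurentPoly m) (RatFunField m) p /
      algebraMap (LaurentPoly m) (RatFunField m) θ

theorem algebraMap_ne_zero {θ : LaurentPoly m} (hθ : θ ≠ 0) :
    algebraMap (LaurentPoly m) (RatFunField m) θ ≠ 0 :=
  (map_ne_zero_iff _ (IsFractionRing.injective (LaurentPoly m) (RatFunField m))).2 hθ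

theorem polyMul_comm (θ η : LaurentPoly m) (f : LaurentSer m) :
    polyMul θ (polyMul η f) = polyMul η (polyMul θ f) := by
  rw [← polyMul_mul, mul_comm, polyMul_mul]

theorem SeriesRep.add {f g : LaurentSer m} {r q : RatFunField m} (hf : SeriesRep f r)
    (hg : SeriesRep g q) : SeriesRep (f + g) (r + q) := by
  obtain ⟨θ, p, hθ, hp, rfl⟩ := hf
  obtain ⟨η, p', hη, hp', rfl⟩ := hg
  refine ⟨θ * η, η * p + θ * p', mul_ne_zero hθ hη, ?_, ?_⟩
  · rw [polyMul_add_right, polyMul_mul, polyMul_comm, hp, polyMul_mul, hp', polyMul_coeff,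
      polyMul_coeff, AddMonoidAlgebra.coeff_add, Finsupp.coe_add]
  · rw [div_add_div _ _ (algebraMap_ne_zero hθ) (algebraMap_ne_zero hη), map_add, map_mul, map_mul,
      map_mul]
    ring

theorem SeriesRep.polynomial (p : LaurentPoly m) :
    SeriesRep ⇑p.coeff (algebraMap (LaurentPoly m) (RatFunField m) p) :=
  ⟨1, p, one_ne_zero, by rw [polyMul_coeff, one_mul], by rw [map_one, div_one]⟩

theorem SeriesRep.zero : SeriesRep (0 : LaurentSer m) 0 :=
  ⟨1, 0, one_ne_zero, by rw [polyMul_zero]; rfl, by simp⟩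

theorem SeriesRep.polyMul {f : LaurentSer m} {r : RatFunField m} (hf : SeriesRep f r)
    (η : LaurentPoly m) :
    SeriesRep (RatCone.polyMul η f) (algebraMap (LaurentPoly m) (RatFunField m) η * r) := by
  obtain ⟨θ, p, hθ, hp, rfl⟩ := hf
  exact ⟨θ, η * p, hθ, by rw [polyMul_comm, hp, polyMul_coeff], by rw [map_mul, mul_div_assoc]⟩

theorem SeriesRep.zsmul {f : LaurentSer m} {r : RatFunField m} (hf : SeriesRep f r) (c : ℤ) :
    SeriesRep (c • f) (c * r) := by
  convert hf.polyMul (AddMonoidAlgebra.single 0 c) using 1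
  · rw [polyMul_single]
    simp only [sub_zero]
    rfl
  · congr 1
    have : (AddMonoidAlgebra.single 0 c : LaurentPoly m) = (c : LaurentPoly m) := by
      rw [AddMonoidAlgebra.intCast_def]
      simp
    rw [this, map_intCast]

theorem SeriesRep.sum {ι : Type*} (s : Finset ι) {f : ι → LaurentSer m} {r : ι → RatFunField m}
    (h : ∀ i ∈ s, SeriesRep (f i) (r i)) : SeriesRep (∑ i ∈ s, f i) (∑ i ∈ s, r i) := by
  classical
  induction s using Finset.induction_on with
  | empty => exact SeriesRep.zero
  | insert a s ha ih =>
    rw [Finset.sum_insert ha, Finset.sum_insert ha]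
    exact (h a (Finset.mem_insert_self a s)).add
      (ih fun i hi => h i (Finset.mem_insert_of_mem hi))

theorem SeriesRep.exists_of_polyMul {f g : LaurentSer m} {η : LaurentPoly m} (hη : η ≠ 0)
    (h : RatCone.polyMul η f = g) (hg : ∃ r, SeriesRep g r) : ∃ r, SeriesRep f r := by
  obtain ⟨_, θ, p, hθ, hp, -⟩ := hg
  exact ⟨_, θ * η, p, mul_ne_zero hθ hη, by rw [polyMul_mul, h, hp], rfl⟩

/-- The Laurent polynomial `1 - exp(w)`. -/
noncomputable def oneSubExp (w : Fin m → ℤ) : LaurentPoly m :=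
  AddMonoidAlgebra.single 0 1 + AddMonoidAlgebra.single w (-1)

theorem oneSubExp_ne_zero {w : Fin m → ℤ} (hw : w ≠ 0) : oneSubExp w ≠ 0 := by
  intro h
  have := congrArg (fun p : LaurentPoly m => p.coeff 0) h
  simp [oneSubExp, hw] at this

theorem polyMul_oneSubExp (w : Fin m → ℤ) (f : LaurentSer m) :
    polyMul (oneSubExp w) f = fun x => f x - f (x - w) := by
  rw [oneSubExp, polyMul_add, polyMul_single, polyMul_single]
  funext x
  simp [sub_eq_add_neg]

theorem exists_seriesRep_of_finite {F : Set (Fin m → ℤ)} (hF : F.Finite) :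
    ∃ r, SeriesRep (F.indicator 1) r := by
  classical
  refine ⟨_, (?_ : F.indicator 1 = ⇑(∑ a ∈ hF.toFinset,
    AddMonoidAlgebra.single a 1 : LaurentPoly m).coeff) ▸ SeriesRep.polynomial _⟩
  funext x
  simp [AddMonoidAlgebra.coeff_sum, Finsupp.single_apply, Set.indicator_apply]

/-- Induction on the generators. Adding w to M gives M' = M ∪ (w + M'), so [F+M'] - [w+F+M'] = [F+M]
- [(F+M) ∩ (w+F+M')]. Both sets on the right are finitely generated over M, and the left side is (1
- exp(w)) S(F+M'). -/
theorem FinGen.exists_seriesRep {M : AddSubmonoid (Fin m → ℤ)} (hM : M.FG)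
    {T : Set (Fin m → ℤ)} (hT : FinGen M T) : ∃ r, SeriesRep (T.indicator 1) r := by
  classical
  obtain ⟨W, rfl⟩ := hM
  induction W using Finset.induction_on generalizing T with
  | empty =>
    obtain ⟨F, hF, rfl⟩ := hT
    simpa using exists_seriesRep_of_finite hF
  | insert w W _ ih =>
    by_cases hw : w = 0
    · rw [hw, Finset.coe_insert, AddSubmonoid.closure_insert_zero] at hT
      exact ih hT
    obtain ⟨F, hF, rfl⟩ := hT
    set M := AddSubmonoid.closure (W : Set (Fin m → ℤ)) with hM
    set M' := AddSubmonoid.closure (↑(insert w W) : Set (Fin m → ℤ)) with hM'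
    have hMM : M ≤ M' := AddSubmonoid.closure_mono (by simp)
    have hwM : w ∈ M' := AddSubmonoid.subset_closure (by simp)
    have hM'w : ∀ y ∈ M', y ∈ M ∨ y - w ∈ M' := by
      intro y hy
      rw [hM', Finset.coe_insert, Set.insert_eq, AddSubmonoid.closure_union,
        AddSubmonoid.mem_sup] at hy
      obtain ⟨a, ha, b, hb, rfl⟩ := hy
      obtain ⟨n, rfl⟩ := AddSubmonoid.mem_closure_singleton.1 ha
      rcases n with _ | n
      · left
        simpa using hb
      · right
        have : (n + 1) • w + b - w = n • w + b := by
          rw [succ_nsmul]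
          abel
        rw [this]
        exact add_mem (nsmul_mem hwM n) (hMM hb)
    have hT₀ : FinGen M (F + (M : Set (Fin m → ℤ))) := ⟨F, hF, rfl⟩
    have hN : FinGen M ((F + (M : Set (Fin m → ℤ))) ∩
        {x | x - w ∈ F + (M' : Set (Fin m → ℤ))}) := by
      refine FinGen.of_subset ⟨W, rfl⟩ hT₀ Set.inter_subset_left ?_
      rintro x ⟨⟨f, hf, y, hy, rfl⟩, f', hf', y', hy', h⟩ z hz
      refine ⟨⟨f, hf, y + z, add_mem hy hz, (add_assoc _ _ _).symm⟩, f', hf', y' + z,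
        add_mem hy' (hMM hz), ?_⟩
      simp only at h ⊢
      rw [← add_assoc, h]
      abel
    obtain ⟨r, hr⟩ := ih hT₀
    obtain ⟨q, hq⟩ := ih hN
    refine SeriesRep.exists_of_polyMul (oneSubExp_ne_zero hw) ?_ ⟨_, hr.add (hq.zsmul (-1))⟩
    rw [polyMul_oneSubExp]
    funext x
    have h1 : x ∈ F + (M : Set (Fin m → ℤ)) → x ∈ F + (M' : Set (Fin m → ℤ)) :=
      fun h => Set.add_subset_add_left hMM h
    have h2 : x - w ∈ F + (M' : Set (Fin m → ℤ)) → x ∈ F + (M' : Set (Fin m → ℤ)) := by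
      rintro ⟨f, hf, y, hy, h⟩
      refine ⟨f, hf, y + w, add_mem hy hwM, ?_⟩
      simp only at h ⊢
      rw [← add_assoc, h, sub_add_cancel]
    have h3 : x ∈ F + (M' : Set (Fin m → ℤ)) →
        x ∈ F + (M : Set (Fin m → ℤ)) ∨ x - w ∈ F + (M' : Set (Fin m → ℤ)) := by
      rintro ⟨f, hf, y, hy, rfl⟩
      rcases hM'w y hy with h | h
      · exact Or.inl ⟨f, hf, y, h, rfl⟩
      · exact Or.inr ⟨f, hf, y - w, h, by simp only; abel⟩
    simp only [Set.indicator_apply, Pi.add_apply, Pi.smul_apply, Set.mem_inter_iff,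
      Set.mem_ofPred_eq, Pi.one_apply]
    by_cases ha : x ∈ F + (M' : Set (Fin m → ℤ))
    · by_cases hb : x ∈ F + (M : Set (Fin m → ℤ)) <;>
        by_cases hc : x - w ∈ F + (M' : Set (Fin m → ℤ))
      · simp [ha, hb, hc]
      · simp [ha, hb, hc]
      · simp [ha, hb, hc]
      · exact absurd (h3 ha) (by simp [hb, hc])
    · simp [ha, mt h1 ha, mt h2 ha]

theorem represents_zero_of_periodic {s : Set (Fin m → ℝ)} {w : Fin m → ℤ} (hw : w ≠ 0)
    (h : ∀ x : Fin m → ℝ, (x - fun i => (w i : ℝ)) ∈ s ↔ x ∈ s) : Represents s 0 := by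
  classical
  refine ⟨oneSubExp w, 0, oneSubExp_ne_zero hw, ?_, by simp⟩
  rw [polyMul_oneSubExp]
  funext x
  have := h fun i => (x i : ℝ)
  have e : (fun i => ((x - w) i : ℝ)) = (fun i => (x i : ℝ)) - fun i => (w i : ℝ) := by
    funext i
    simp
  simp only [genSeries, Set.indicator_apply, Set.mem_ofPred_eq, e, this, Pi.one_apply, sub_self]
  rfl

end Series

/-! ### Lattice points of rational cones. -/

section Lattice

variable {m : ℕ}

/-- The lattice points of a subset of `ℝ^m`. -/
def latticePoints (s : Set (Fin m → ℝ)) : Set (Fin m → ℤ) := {x | (fun i => (x i : ℝ)) ∈ s}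

theorem exists_pos_mul_eq_intCast (q : Fin m → ℚ) :
    ∃ N : ℕ, 0 < N ∧ ∃ w : Fin m → ℤ, ∀ j, (N : ℝ) * (q j : ℝ) = w j := by
  refine ⟨∏ j, (q j).den, Finset.prod_pos fun j _ => (q j).pos,
    fun j => (∏ i ∈ Finset.univ.erase j, ((q i).den : ℤ)) * (q j).num, fun j => ?_⟩
  rw [← Finset.mul_prod_erase _ _ (Finset.mem_univ j)]
  have : ((q j).den : ℝ) * (q j : ℝ) = (q j).num := by
    exact_mod_cast Rat.den_mul_eq_num (q j)
  push_cast
  rw [← this]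
  ring

theorem IsRationalCone.exists_finGen {v : Fin m → ℚ} {C : Set (Fin m → ℝ)}
    (hC : IsRationalCone v C) :
    ∃ M : AddSubmonoid (Fin m → ℤ), M.FG ∧ FinGen M (latticePoints C) := by
  obtain ⟨k, u, rfl⟩ := hC
  choose N hN w hw using fun i => exists_pos_mul_eq_intCast (u i)
  -- The lattice points of the bounded parallelepiped spanned at v by integer multiples of the
  -- generators. Removing the integer parts of the coefficients brings any lattice point of C into
  -- it.
  let F : Set (Fin m → ℤ) := {x | ∃ β : Fin k → ℝ, (∀ i, 0 ≤ β i) ∧ (∀ i, β i ≤ 1) ∧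
    ∀ j, (x j : ℝ) = v j + ∑ i, β i * w i j}
  have hF : F.Finite := by
    let B : Fin m → ℤ := fun j => ⌈|(v j : ℝ)| + ∑ i, |(w i j : ℝ)|⌉
    refine (Set.finite_Icc (-B) B).subset ?_
    rintro x ⟨β, hβ, hβ', hx⟩
    have hb : ∀ j, |(x j : ℝ)| ≤ B j := by
      intro j
      refine le_trans ?_ (Int.le_ceil _)
      rw [hx j]
      refine (abs_add_le _ _).trans (add_le_add_right ?_ _)
      refine (Finset.abs_sum_le_sum_abs _ _).trans (Finset.sum_le_sum fun i _ => ?_)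
      rw [abs_mul, abs_of_nonneg (hβ i)]
      exact mul_le_of_le_one_left (abs_nonneg _) (hβ' i)
    refine ⟨fun j => ?_, fun j => ?_⟩
    · have := (abs_le.1 (hb j)).1
      exact_mod_cast this
    · exact_mod_cast (abs_le.1 (hb j)).2
  refine ⟨AddSubmonoid.closure (Set.range w), ⟨(Set.finite_range w).toFinset, by simp⟩, F, hF, ?_⟩
  ext x
  constructor
  · rintro ⟨α, hα, hx⟩
    have hx : ∀ j, (x j : ℝ) = v j + ∑ i, α i / N i * w i j := by
      intro j
      refine (hx j).trans (congrArg _ (Finset.sum_congr rfl fun i _ => ?_))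
      have : (N i : ℝ) ≠ 0 := by exact_mod_cast (hN i).ne'
      rw [← hw]
      field_simp
    refine ⟨x - ∑ i, ⌊α i / N i⌋₊ • w i, ⟨fun i => α i / N i - ⌊α i / N i⌋₊, fun i => ?_,
      fun i => ?_, fun j => ?_⟩, ∑ i, ⌊α i / N i⌋₊ • w i, ?_, sub_add_cancel _ _⟩
    · exact sub_nonneg.2 (Nat.floor_le (div_nonneg (hα i) (Nat.cast_nonneg _)))
    · linarith [Nat.lt_floor_add_one (α i / N i)]
    · have e : (((∑ i, ⌊α i / N i⌋₊ • w i) j : ℤ) : ℝ) = ∑ i, (⌊α i / N i⌋₊ : ℝ) * w i j := by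
        simp
      rw [Pi.sub_apply, Int.cast_sub, e, hx j]
      simp only [sub_mul, Finset.sum_sub_distrib]
      ring
    · exact sum_mem fun i _ => nsmul_mem (AddSubmonoid.subset_closure (Set.mem_range_self i)) _
  · rintro ⟨f, ⟨β, hβ, _, hf⟩, y, hy, rfl⟩
    have hy' : ∃ γ : Fin k → ℝ, (∀ i, 0 ≤ γ i) ∧ ∀ j, (y j : ℝ) = ∑ i, γ i * w i j := by
      induction hy using AddSubmonoid.closure_induction with
      | mem y hy =>
        obtain ⟨i, rfl⟩ := hy
        refine ⟨Pi.single i 1, fun i' => ?_, fun j => ?_⟩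
        · by_cases h : i' = i
          · subst h
            simp
          · simp [h]
        · simp [Pi.single_apply]
      | zero => exact ⟨0, fun i => le_rfl, fun j => by simp⟩
      | add a b _ _ ha hb =>
        obtain ⟨γ, hγ, h⟩ := ha
        obtain ⟨δ, hδ, h'⟩ := hb
        exact ⟨γ + δ, fun i => add_nonneg (hγ i) (hδ i), fun j => by
          simp [h, h', add_mul, Finset.sum_add_distrib]⟩
    obtain ⟨γ, hγ, hyγ⟩ := hy'
    refine ⟨fun i => (β i + γ i) * N i, fun i => mul_nonneg (add_nonneg (hβ i) (hγ i))
      (Nat.cast_nonneg _), fun j => ?_⟩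
    simp only [Pi.add_apply, Int.cast_add, hf j, hyγ j, mul_assoc, hw, add_mul,
      Finset.sum_add_distrib]
    ring

theorem IsRationalCone.hasSigma_inter {v v' : Fin m → ℚ} {C D : Set (Fin m → ℝ)}
    (hC : IsRationalCone v C) (hD : IsRationalCone v' D) : HasSigma (C ∩ D) := by
  obtain ⟨M, hM, hT⟩ := hC.exists_finGen
  obtain ⟨M', hM', hT'⟩ := hD.exists_finGen
  exact FinGen.exists_seriesRep (fg_inf hM hM') (FinGen.inter hM hM' hT hT')

theorem IsRationalCone.hasSigma {v : Fin m → ℚ} {C : Set (Fin m → ℝ)}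
    (hC : IsRationalCone v C) : HasSigma C := by
  simpa using hC.hasSigma_inter hC

end Lattice
end RatCone

/-! ### From cones at the origin to cones with vertex v, and the theorem. -/

namespace RatCone

open Module

variable {m : ℕ}

/-- The translate of the cone `K` with vertex `v`. -/
def shift (v : Fin m → ℚ) (K : PointedCone ℝ (Fin m → ℝ)) : Set (Fin m → ℝ) :=
  {x | (x - fun j => (v j : ℝ)) ∈ K}

/-- The real cone generated by a family of rational vectors. -/
def ratHull {ι : Type*} (u : ι → Fin m → ℚ) : PointedCone ℝ (Fin m → ℝ) :=
  PointedCone.hull ℝ (Set.range fun i j => (u i j : ℝ))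

variable {v : Fin m → ℚ} {K G : PointedCone ℝ (Fin m → ℝ)} {C D : Set (Fin m → ℝ)}

theorem mem_shift {x : Fin m → ℝ} : x ∈ shift v K ↔ (x - fun j => (v j : ℝ)) ∈ K := Iff.rfl

theorem vertex_mem_shift : (fun j => (v j : ℝ)) ∈ shift v K := by
  rw [mem_shift, sub_self]
  exact zero_mem _

theorem vertex_add_mem_shift {w : Fin m → ℝ} : (fun j => (v j : ℝ)) + w ∈ shift v K ↔ w ∈ K := by
  rw [mem_shift, add_sub_cancel_left]

theorem shift_injective : Function.Injective (shift v) := by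
  intro K L h
  ext w
  rw [← vertex_add_mem_shift (v := v), h, vertex_add_mem_shift]

theorem convex_shift : Convex ℝ (shift v K) := by
  intro x hx y hy a b ha hb hab
  have := add_mem (PointedCone.smul_mem _ ha hx) (PointedCone.smul_mem _ hb hy)
  rw [mem_shift]
  convert this using 1
  nth_rewrite 1 [← one_smul ℝ fun j => (v j : ℝ)]
  rw [← hab]
  module

theorem fg_ratHull {ι : Type*} [Finite ι] (u : ι → Fin m → ℚ) : (ratHull u).FG :=
  Submodule.fg_span (Set.finite_range _)

theorem shift_ratHull {ι : Type*} [Fintype ι] (u : ι → Fin m → ℚ) :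
    shift v (ratHull u) = {x | ∃ α : ι → ℝ, (∀ i, 0 ≤ α i) ∧
      ∀ j, x j = (v j : ℝ) + ∑ i, α i * (u i j : ℝ)} := by
  ext x
  rw [mem_shift, ratHull, mem_hull_range_iff]
  refine exists_congr fun α => and_congr_right fun _ => ?_
  rw [funext_iff]
  refine forall_congr' fun j => ?_
  simp only [Pi.sub_apply, Finset.sum_apply, Pi.smul_apply, smul_eq_mul]
  rw [sub_eq_iff_eq_add']

theorem IsRationalCone.exists_eq_shift (hC : IsRationalCone v C) :
    ∃ (k : ℕ) (u : Fin k → Fin m → ℚ), C = shift v (ratHull u) := by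
  obtain ⟨k, u, rfl⟩ := hC
  exact ⟨k, u, (shift_ratHull u).symm⟩

theorem isRationalCone_shift_ratHull {ι : Type*} [Fintype ι] (u : ι → Fin m → ℚ) :
    IsRationalCone v (shift v (ratHull u)) := by
  refine ⟨Fintype.card ι, u ∘ (Fintype.equivFin ι).symm, ?_⟩
  rw [← shift_ratHull, ratHull, ratHull]
  congr 2
  exact ((Fintype.equivFin ι).symm.surjective.range_comp fun i j => (u i j : ℝ)).symm

/-! ### Exposed faces -/

theorem mem_of_sum_mem_minFace {ι : Type*} [Fintype ι] {u : ι → Fin m → ℝ} {y : Fin m → ℝ}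
    {α : ι → ℝ} (hα : ∀ i, 0 ≤ α i) (hu : ∀ i, u i ∈ K) (h : ∑ i, α i • u i ∈ minFace K y) {i : ι}
    (hi : 0 < α i) : u i ∈ minFace K y := by
  classical
  refine minFace_le_minFace h ⟨hu i, 1 / α i, by positivity, ?_⟩
  rw [← Finset.add_sum_erase _ _ (Finset.mem_univ i), smul_add, smul_smul,
    one_div_mul_cancel hi.ne', one_smul, add_sub_cancel_left]
  exact PointedCone.smul_mem _ (by positivity)
    (Submodule.sum_mem _ fun j _ => PointedCone.smul_mem _ (hα j) (hu j))

theorem apply_eq_zero_of_sum {ι : Type*} [Fintype ι] {u : ι → Fin m → ℝ} {α : ι → ℝ}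
    {l : (Fin m → ℝ) →L[ℝ] ℝ} (hα : ∀ i, 0 ≤ α i) (hl : ∀ i, l (u i) ≤ 0)
    (h : l (∑ i, α i • u i) = 0) {i : ι} (hi : 0 < α i) : l (u i) = 0 := by
  simp only [map_sum, map_smul, smul_eq_mul] at h
  have := (Finset.sum_eq_zero_iff_of_nonpos fun i _ =>
    mul_nonpos_of_nonneg_of_nonpos (hα i) (hl i)).1 h i (Finset.mem_univ i)
  exact (mul_eq_zero.1 this).resolve_left hi.ne'

/-- A functional bounded above on K is ≤ 0 there, so the exposed face is K ∩ ker l: the smallest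
face containing the sum of the generators killed by l. -/
theorem exists_face_of_isExposed (hK : K.FG) {Γ : Set (Fin m → ℝ)}
    (hΓ : IsExposed ℝ (shift v K) Γ) (hne : Γ.Nonempty) : ∃ G ∈ faces K, Γ = shift v G := by
  classical
  obtain ⟨l, hl⟩ := hΓ hne
  obtain ⟨x₀, hx₀⟩ := hne
  rw [hl] at hx₀
  have hlK : ∀ w ∈ K, l w ≤ 0 := by
    intro w hw
    have h1 : x₀ + w ∈ shift v K := by
      rw [mem_shift, add_sub_right_comm]
      exact add_mem hx₀.1 hw
    have := hx₀.2 _ h1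
    rw [map_add] at this
    linarith
  obtain ⟨k, u, rfl⟩ := exists_fin_of_fg hK
  set K := PointedCone.hull ℝ (Set.range u) with hKdef
  have hu : ∀ i, u i ∈ K := fun i => Submodule.subset_span ⟨i, rfl⟩
  let y := ∑ i with l (u i) = 0, u i
  have hy : y ∈ K := Submodule.sum_mem _ fun i _ => hu i
  have hly : l y = 0 := by
    rw [map_sum]
    exact Finset.sum_eq_zero fun i hi => (Finset.mem_filter.1 hi).2
  have key : ∀ w, w ∈ minFace K y ↔ w ∈ K ∧ l w = 0 := by
    intro w
    constructor
    · rintro ⟨hw, s, hs, h⟩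
      refine ⟨hw, le_antisymm (hlK w hw) ?_⟩
      have := hlK _ h
      rw [map_sub, map_smul, hly, smul_zero] at this
      linarith
    · rintro ⟨hw, hlw⟩
      obtain ⟨α, hα, rfl⟩ := mem_hull_range_iff.1 hw
      refine Submodule.sum_mem _ fun i _ => ?_
      rcases (hα i).eq_or_lt with h0 | hi
      · rw [← h0, zero_smul]
        exact zero_mem _
      · refine PointedCone.smul_mem _ hi.le ⟨hu i, 1, zero_le_one, ?_⟩
        have hli := apply_eq_zero_of_sum hα (fun i => hlK _ (hu i)) hlw hi
        rw [one_smul]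
        simp only [y]
        rw [← Finset.add_sum_erase _ _ (show i ∈ Finset.univ.filter fun i => l (u i) = 0 by
          simpa using hli), add_sub_cancel_left]
        exact Submodule.sum_mem _ fun j _ => hu j
  refine ⟨minFace K y, ⟨y, hy, rfl⟩, ?_⟩
  rw [hl]
  ext x
  rw [mem_shift, key]
  refine and_congr_right fun hx => ?_
  constructor
  · intro h
    refine le_antisymm (hlK _ hx) ?_
    have := h _ vertex_mem_shift
    rw [map_sub]
    linarith
  · intro h z hz
    have := hlK _ hz
    rw [map_sub] at this h
    linarith

/-- For each generator u i outside G, Farkas separates -u i from the tangent cone. The sum of these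
functionals vanishes on G and is negative on those generators. -/
theorem isExposed_shift (hK : K.FG) (hG : G ∈ faces K) : IsExposed ℝ (shift v K) (shift v G) := by
  classical
  intro _
  have hT := fg_tangent hK hG
  obtain ⟨y, hy, rfl⟩ := hG
  obtain ⟨k, u, rfl⟩ := exists_fin_of_fg hK
  set K := PointedCone.hull ℝ (Set.range u) with hKdef
  have hu : ∀ i, u i ∈ K := fun i => Submodule.subset_span ⟨i, rfl⟩
  have hsep : ∀ i, ∃ l : (Fin m → ℝ) →L[ℝ] ℝ, (∀ w ∈ tangent K (minFace K y), l w ≤ 0) ∧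
      (u i ∉ minFace K y → l (u i) < 0) := by
    intro i
    by_cases hi : u i ∈ minFace K y
    · exact ⟨0, by simp, by simp [hi]⟩
    · have : -u i ∉ tangent K (minFace K y) := by
        intro h
        obtain ⟨s, hs, h⟩ := (mem_tangent_minFace hy).1 h
        exact hi ⟨hu i, s, hs, by rwa [neg_add_eq_sub] at h⟩
      obtain ⟨l, h1, h2⟩ := exists_separating_of_fg hT this
      exact ⟨l, h1, fun _ => by simpa using h2⟩
  choose l hl hlu using hsep
  have hL : ∀ w ∈ tangent K (minFace K y), (∑ i, l i) w ≤ 0 := by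
    intro w hw
    rw [sum_apply]
    exact Finset.sum_nonpos fun i _ => hl i w hw
  have key : ∀ w ∈ K, (w ∈ minFace K y ↔ (∑ i, l i) w = 0) := by
    intro w hw
    constructor
    · intro h
      have h1 := hL _ (le_tangent hw)
      have h2 := hL (-w) ⟨w, h, by simp⟩
      rw [map_neg] at h2
      linarith
    · intro h
      obtain ⟨α, hα, rfl⟩ := mem_hull_range_iff.1 hw
      refine Submodule.sum_mem _ fun i _ => ?_
      rcases (hα i).eq_or_lt with h0 | hi
      · rw [← h0, zero_smul]
        exact zero_mem _
      · refine PointedCone.smul_mem _ hi.le ?_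
        have hli := apply_eq_zero_of_sum hα (fun i => hL _ (le_tangent (hu i))) h hi
        by_contra hc
        have h1 := hlu i hc
        rw [sum_apply, Finset.sum_eq_zero_iff_of_nonpos
          fun j _ => hl j _ (le_tangent (hu i))] at hli
        exact h1.ne (hli i (Finset.mem_univ i))
  refine ⟨∑ i, l i, ?_⟩
  ext x
  constructor
  · intro hx
    refine ⟨minFace_le hx, fun z hz => ?_⟩
    have h1 := (key _ (minFace_le hx)).1 hx
    have h2 := hL _ (le_tangent hz)
    rw [map_sub] at h1 h2
    linarith
  · rintro ⟨hx, h⟩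
    refine (key _ hx).2 (le_antisymm (hL _ (le_tangent hx)) ?_)
    have := h _ vertex_mem_shift
    rw [map_sub]
    linarith

/-- Prolonging the segment from y through x inside the face shows that a multiple of x dominates y.
-/
theorem minFace_eq_of_mem_intrinsicInterior (hG : G ∈ faces K) {x : Fin m → ℝ}
    (hx : x ∈ intrinsicInterior ℝ (shift v G)) :
    (x - fun j => (v j : ℝ)) ∈ K ∧ minFace K (x - fun j => (v j : ℝ)) = G := by
  obtain ⟨y, hy, rfl⟩ := hG
  have hxG : (x - fun j => (v j : ℝ)) ∈ minFace K y :=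
    mem_shift.1 (intrinsicInterior_subset hx)
  refine ⟨hxG.1, (minFace_eq_iff hxG.1 hy).2 ⟨hxG, hy, ?_⟩⟩
  obtain ⟨ε, hε, h⟩ := exists_pos_mem_of_mem_intrinsicInterior
    (vertex_add_mem_shift.2 (self_mem_minFace hy)) hx
  refine ⟨1 / ε + 1, by positivity, ?_⟩
  have := PointedCone.smul_mem _ (show 0 ≤ 1 / ε by positivity) (mem_shift.1 h)
  convert minFace_le this using 1
  rw [add_sub_right_comm, smul_add, smul_smul, one_div_mul_cancel hε.ne']
  module

theorem faceCone_shift (hG : G ∈ faces K) :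
    faceCone (shift v K) (shift v G) = shift v (tangent K G) := by
  ext z
  constructor
  · rintro ⟨x, hx, p, hp, α, hα, rfl⟩
    obtain ⟨hxK, rfl⟩ := minFace_eq_of_mem_intrinsicInterior hG hx
    rw [mem_shift, mem_tangent_minFace hxK]
    refine ⟨α, hα, ?_⟩
    convert add_mem hxK (PointedCone.smul_mem _ hα hp) using 1
    module
  · intro hz
    obtain ⟨x, hx⟩ : (intrinsicInterior ℝ (shift v G)).Nonempty :=
      Set.Nonempty.intrinsicInterior convex_shift ⟨_, vertex_mem_shift⟩
    obtain ⟨hxK, rfl⟩ := minFace_eq_of_mem_intrinsicInterior hG hx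
    rw [mem_shift, mem_tangent_minFace hxK] at hz
    obtain ⟨s, hs, h⟩ := hz
    -- The factor s + 1 replaces s to remain positive when s = 0.
    refine ⟨x, hx, _, vertex_add_mem_shift.2
      (PointedCone.smul_mem _ (show 0 ≤ 1 / (s + 1) by positivity) h), s + 1, by positivity, ?_⟩
    have e : (s + 1) * (1 / (s + 1)) = 1 := by field_simp
    rw [smul_sub, smul_add, smul_smul, e]
    module

theorem dim_shift : dim (shift v G) = finrank ℝ (Submodule.span ℝ (G : Set (Fin m → ℝ))) := by
  have : vectorSpan ℝ (shift v G) = Submodule.span ℝ (G : Set (Fin m → ℝ)) := by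
    rw [vectorSpan_eq_span_vsub_set_right ℝ vertex_mem_shift]
    congr 1
    ext w
    constructor
    · rintro ⟨x, hx, rfl⟩
      exact hx
    · intro hw
      exact ⟨_, vertex_add_mem_shift.2 hw, by simp⟩
  rw [dim, this]

theorem exists_face_of_mem_posFaces (hK : K.FG) {Γ : Set (Fin m → ℝ)}
    (hΓ : Γ ∈ posFaces (shift v K)) :
    ∃ G ∈ faces K, 0 < finrank ℝ (Submodule.span ℝ (G : Set (Fin m → ℝ))) ∧ Γ = shift v G := by
  obtain ⟨hΓ, hd⟩ := hΓ
  have hne : Γ.Nonempty := by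
    rw [Set.nonempty_iff_ne_empty]
    rintro rfl
    have : vectorSpan ℝ (∅ : Set (Fin m → ℝ)) = ⊥ := vectorSpan_empty ℝ _
    rw [dim, this, finrank_bot] at hd
    exact lt_irrefl _ hd
  obtain ⟨G, hG, rfl⟩ := exists_face_of_isExposed hK hΓ hne
  exact ⟨G, hG, by rwa [dim_shift] at hd, rfl⟩

theorem finite_posFaces (hK : K.FG) : (posFaces (shift v K)).Finite := by
  refine ((finite_faces hK).image (shift v)).subset fun Γ hΓ => ?_
  obtain ⟨G, hG, -, rfl⟩ := exists_face_of_mem_posFaces hK hΓ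
  exact ⟨G, hG, rfl⟩

/-- The point y defining G may be irrational, so the added generators are the negatives of the u i
lying in G, with 0 as filler for the others. -/
theorem isRationalCone_tangent {k : ℕ} (u : Fin k → Fin m → ℚ) (hG : G ∈ faces (ratHull u)) :
    IsRationalCone v (shift v (tangent (ratHull u) G)) := by
  classical
  have hu : ∀ i, (fun j => (u i j : ℝ)) ∈ ratHull u := fun i => Submodule.subset_span ⟨i, rfl⟩
  have : tangent (ratHull u) G = ratHull (Sum.elim u fun i =>
      if (fun j => (u i j : ℝ)) ∈ G then -u i else 0) := by
    obtain ⟨y, hy, rfl⟩ := hG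
    apply le_antisymm
    · rintro w ⟨z, hz, hw⟩
      have h1 : ratHull u ≤ ratHull (Sum.elim u fun i =>
          if (fun j => (u i j : ℝ)) ∈ minFace (ratHull u) y then -u i else 0) := by
        refine Submodule.span_mono ?_
        rintro _ ⟨i, rfl⟩
        exact ⟨Sum.inl i, rfl⟩
      have h2 : -z ∈ ratHull (Sum.elim u fun i =>
          if (fun j => (u i j : ℝ)) ∈ minFace (ratHull u) y then -u i else 0) := by
        obtain ⟨α, hα, rfl⟩ := mem_hull_range_iff.1 (minFace_le hz)
        rw [← Finset.sum_neg_distrib]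
        refine Submodule.sum_mem _ fun i _ => ?_
        rcases (hα i).eq_or_lt with h0 | hi
        · rw [← h0, zero_smul, neg_zero]
          exact zero_mem _
        · have hi' := mem_of_sum_mem_minFace hα hu hz hi
          rw [← smul_neg]
          refine PointedCone.smul_mem _ hi.le (Submodule.subset_span ⟨Sum.inr i, ?_⟩)
          simp only [Sum.elim_inr, if_pos hi']
          ext j
          simp
      have := add_mem (h1 hw) h2
      rwa [add_neg_cancel_right] at this
    · rw [ratHull, PointedCone.hull, Submodule.span_le]
      rintro _ ⟨i | i, rfl⟩
      · exact le_tangent (hu i)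
      · simp only [Sum.elim_inr]
        split_ifs with h
        · refine ⟨_, h, ?_⟩
          convert zero_mem (ratHull u) using 1
          ext j
          simp
        · have e : (fun j => (((0 : Fin m → ℚ) j : ℚ) : ℝ)) = 0 := by
            ext j
            simp
          rw [e]
          exact zero_mem _
  rw [this]
  exact isRationalCone_shift_ratHull _

/-! ### Cones that contain a line -/

/-- A functional that is ≤ 0 on K and positive on w would reach the value 1 on the line. -/
theorem mem_of_line_subset_shift (hK : K.FG) {p w : Fin m → ℝ}
    (h : ∀ a : ℝ, p + a • w ∈ shift v K) : w ∈ K := by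
  by_contra hw
  obtain ⟨l, hl, hlw⟩ := exists_separating_of_fg hK hw
  have := hl _ (h ((1 - l (p - fun j => (v j : ℝ))) / l w))
  rw [add_sub_right_comm, map_add, map_smul, smul_eq_mul, div_mul_cancel₀ _ hlw.ne'] at this
  linarith

/-- Write w = ∑ α i u i. Each non-zero term has its negative, -w plus the other terms, in K; so some
rational generator spans a line, and clearing denominators makes it integral. -/
theorem exists_int_line {k : ℕ} {u : Fin k → Fin m → ℚ}
    (h : IsDegenerate (shift v (ratHull u))) :
    ∃ w : Fin m → ℤ, w ≠ 0 ∧ (fun j => (w j : ℝ)) ∈ ratHull u ∧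
      -(fun j => (w j : ℝ)) ∈ ratHull u := by
  classical
  obtain ⟨p, w, hw, hline⟩ := h
  have hu : ∀ i, (fun j => (u i j : ℝ)) ∈ ratHull u := fun i => Submodule.subset_span ⟨i, rfl⟩
  have h1 : w ∈ ratHull u := mem_of_line_subset_shift (fg_ratHull u) hline
  have h2 : -w ∈ ratHull u := mem_of_line_subset_shift (v := v) (p := p) (fg_ratHull u) fun a => by
    have := hline (-a)
    rwa [neg_smul, ← smul_neg] at this
  obtain ⟨α, hα, hwα⟩ := mem_hull_range_iff.1 h1
  obtain ⟨i, hi⟩ : ∃ i, α i • (fun j => (u i j : ℝ)) ≠ 0 := by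
    by_contra! hc
    exact hw (hwα.trans (Finset.sum_eq_zero fun i _ => hc i))
  obtain ⟨hαi, hui⟩ := smul_ne_zero_iff.1 hi
  have hαi : 0 < α i := lt_of_le_of_ne (hα i) hαi.symm
  have hneg : -(fun j => (u i j : ℝ)) ∈ ratHull u := by
    have h3 : -(α i • fun j => (u i j : ℝ)) ∈ ratHull u := by
      rw [← Finset.add_sum_erase _ _ (Finset.mem_univ i)] at hwα
      have := add_mem h2 (Submodule.sum_mem (ratHull u) fun j (_ : j ∈ Finset.univ.erase i) =>
        PointedCone.smul_mem _ (hα j) (hu j))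
      convert this using 1
      rw [hwα]
      abel
    have := PointedCone.smul_mem _ (show 0 ≤ 1 / α i by positivity) h3
    rwa [smul_neg, smul_smul, one_div_mul_cancel hαi.ne', one_smul] at this
  obtain ⟨N, hN, w', hw'⟩ := exists_pos_mul_eq_intCast (u i)
  have e : (fun j => (w' j : ℝ)) = (N : ℝ) • fun j => (u i j : ℝ) := by
    ext j
    simp [hw']
  refine ⟨w', ?_, ?_, ?_⟩
  · rintro rfl
    refine smul_ne_zero (show (N : ℝ) ≠ 0 by exact_mod_cast hN.ne') hui (e.symm.trans ?_)
    ext j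
    simp
  · rw [e]
    exact PointedCone.smul_mem _ (Nat.cast_nonneg _) (hu i)
  · rw [e, ← smul_neg]
    exact PointedCone.smul_mem _ (Nat.cast_nonneg _) hneg

theorem sub_mem_shift_iff {w : Fin m → ℝ} (h1 : w ∈ K) (h2 : -w ∈ K) (x : Fin m → ℝ) :
    x - w ∈ shift v K ↔ x ∈ shift v K := by
  rw [mem_shift, mem_shift]
  constructor
  · intro h
    have := add_mem h h1
    rwa [sub_right_comm, sub_add_cancel] at this
  · intro h
    have := add_mem h h2
    rwa [← sub_eq_add_neg, sub_right_comm] at this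

/-! ### Cones that contain no line -/

theorem eq_zero_of_not_isDegenerate (h : ¬ IsDegenerate (shift v K)) {w : Fin m → ℝ} (h1 : w ∈ K)
    (h2 : -w ∈ K) : w = 0 := by
  by_contra hw
  refine h ⟨_, w, hw, fun a => vertex_add_mem_shift.2 ?_⟩
  rcases le_total 0 a with ha | ha
  · exact PointedCone.smul_mem _ ha h1
  · rw [← neg_smul_neg]
    exact PointedCone.smul_mem _ (neg_nonneg.2 ha) h2

/-- The smallest face containing 0 is the lineality space, trivial here. -/
theorem bot_mem_faces (h : ¬ IsDegenerate (shift v K)) : ⊥ ∈ faces K := by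
  refine ⟨0, zero_mem _, ?_⟩
  rw [eq_bot_iff]
  rintro w ⟨hw, s, _, hw'⟩
  rw [smul_zero, zero_sub] at hw'
  exact eq_zero_of_not_isDegenerate h hw hw'

theorem tangent_bot : tangent K ⊥ = K := by
  refine le_antisymm ?_ le_tangent
  rintro w ⟨z, hz, h⟩
  rw [(Submodule.mem_bot _).1 hz, add_zero] at h
  exact h

theorem finrank_span_pos_iff :
    0 < finrank ℝ (Submodule.span ℝ (G : Set (Fin m → ℝ))) ↔ G ≠ ⊥ := by
  rw [Nat.pos_iff_ne_zero, Ne, Submodule.finrank_eq_zero, Submodule.span_eq_bot, Ne,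
    Submodule.eq_bot_iff]
  rfl

theorem posFaces_shift (hK : K.FG) : posFaces (shift v K) = shift v '' (faces K \ {⊥}) := by
  ext Γ
  constructor
  · intro h
    obtain ⟨G, hG, hd, rfl⟩ := exists_face_of_mem_posFaces hK h
    exact ⟨G, ⟨hG, finrank_span_pos_iff.1 hd⟩, rfl⟩
  · rintro ⟨G, ⟨hG, hne⟩, rfl⟩
    exact ⟨isExposed_shift hK hG, by rw [dim_shift]; exact finrank_span_pos_iff.2 hne⟩

/-- Each w in the span of K becomes an element of K after adding a multiple of p; subtracting that
multiple stays in L. -/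
theorem affineSpan_subset_shift {L : PointedCone ℝ (Fin m → ℝ)} (hKL : K ≤ L) {p : Fin m → ℝ}
    (hp : p ∈ openFace K K) (hpL : -p ∈ L) :
    (affineSpan ℝ (shift v K) : Set (Fin m → ℝ)) ⊆ shift v L := by
  intro z hz
  have h1 : (z - fun j => (v j : ℝ)) ∈ Submodule.span ℝ (K : Set (Fin m → ℝ)) := by
    have := AffineSubspace.vsub_mem_direction hz (subset_affineSpan ℝ _ (vertex_mem_shift (K := K)))
    rw [direction_affineSpan, vectorSpan_def] at this
    refine Submodule.span_le.2 ?_ this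
    rintro _ ⟨x, hx, y, hy, rfl⟩
    have h := Submodule.sub_mem _ (Submodule.subset_span (R := ℝ) (mem_shift.1 hx))
      (Submodule.subset_span (mem_shift.1 hy))
    rwa [sub_sub_sub_cancel_right] at h
  rw [← SetLike.mem_coe, ← tangent_self] at h1
  have h2 : (z - fun j => (v j : ℝ)) ∈ tangent K (minFace K p) := by
    rw [hp.2]
    exact h1
  obtain ⟨s, hs, h⟩ := (mem_tangent_minFace hp.1).1 h2
  have := add_mem (hKL h) (PointedCone.smul_mem _ hs hpL)
  rwa [smul_neg, add_neg_cancel_right] at this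

theorem genSeries_shift (hK : K.FG) {L : PointedCone ℝ (Fin m → ℝ)} (hKL : K ≤ L)
    (hdeg : ¬ IsDegenerate (shift v K))
    (haff : ¬ (affineSpan ℝ (shift v K) : Set (Fin m → ℝ)) ⊆ shift v L) :
    genSeries (shift v K) = ∑ G ∈ (finite_faces hK).toFinset.erase ⊥,
      ((-1 : ℤ) ^ (finrank ℝ (Submodule.span ℝ (G : Set (Fin m → ℝ))) + 1)) •
        genSeries (shift v (tangent K G) ∩ shift v L) := by
  classical
  funext x
  rw [Finset.sum_apply]
  simp only [genSeries, Pi.smul_apply, Set.indicator_apply, Set.mem_ofPred_eq, Pi.one_apply,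
    Set.mem_inter_iff, smul_eq_mul]
  by_cases hx : (fun i => (x i : ℝ)) ∈ shift v L
  · have := sum_tangent_eq_zero hK (x := (fun i => (x i : ℝ)) - fun j => (v j : ℝ))
      fun h => haff (affineSpan_subset_shift hKL h (by rwa [neg_neg]))
    rw [← Finset.add_sum_erase _ _ (show ⊥ ∈ (finite_faces hK).toFinset by
      simpa using bot_mem_faces hdeg), tangent_bot] at this
    have e : finrank ℝ (Submodule.span ℝ ((⊥ : PointedCone ℝ (Fin m → ℝ)) : Set (Fin m → ℝ)))
        = 0 := by
      simp
    rw [e, pow_zero, one_mul] at this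
    simp only [hx, and_true, pow_succ, mul_neg, mul_one, neg_mul, Finset.sum_neg_distrib, mem_shift]
    linarith
  · have h0 : (fun i => (x i : ℝ)) ∉ shift v K := fun h => hx (hKL h)
    simp [hx, h0]

end RatCone

theorem mainTheorem4 (m : ℕ) (v : Fin m → ℚ) (C D : Set (Fin m → ℝ))
    (hC : RatCone.IsRationalCone v C) (hD : RatCone.IsRationalCone v D)
    (hCD : C ⊆ D) (hD_ne : D ≠ Set.univ)
    (hD_aff : ¬ RatCone.IsDegenerate C → ¬ (affineSpan ℝ C : Set (Fin m → ℝ)) ⊆ D) :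
    (RatCone.posFaces C).Finite ∧
    RatCone.HasSigma C ∧
    (∀ Γ ∈ RatCone.posFaces C, RatCone.HasSigma (RatCone.faceCone C Γ ∩ D)) ∧
    RatCone.sigma C = ∑ᶠ Γ ∈ RatCone.posFaces C,
      (-1) ^ (RatCone.dim Γ + 1) * RatCone.sigma (RatCone.faceCone C Γ ∩ D) := by
  classical
  open RatCone Module in
  have hCσ := hC.hasSigma
  obtain ⟨k, u, rfl⟩ := hC.exists_eq_shift
  obtain ⟨k', u', rfl⟩ := hD.exists_eq_shift
  have hK := fg_ratHull u
  have hKL : ratHull u ≤ ratHull u' := fun w hw =>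
    vertex_add_mem_shift.1 (hCD (vertex_add_mem_shift.2 hw))
  have hσ : ∀ G ∈ faces (ratHull u), HasSigma (shift v (tangent (ratHull u) G) ∩
      shift v (ratHull u')) := fun G hG => (isRationalCone_tangent u hG).hasSigma_inter hD
  refine ⟨finite_posFaces hK, hCσ, ?_, ?_⟩
  · intro Γ hΓ
    obtain ⟨G, hG, -, rfl⟩ := exists_face_of_mem_posFaces hK hΓ
    rw [faceCone_shift hG]
    exact hσ G hG
  by_cases hdeg : IsDegenerate (shift v (ratHull u))
  · obtain ⟨w, hw, h1, h2⟩ := exists_int_line hdeg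
    rw [(represents_zero_of_periodic hw (sub_mem_shift_iff h1 h2)).sigma_eq]
    symm
    refine finsum_mem_eq_zero_of_forall_eq_zero fun Γ hΓ => ?_
    obtain ⟨G, hG, -, rfl⟩ := exists_face_of_mem_posFaces hK hΓ
    rw [faceCone_shift hG, (represents_zero_of_periodic hw fun x => ?_).sigma_eq, mul_zero]
    exact and_congr (sub_mem_shift_iff (le_tangent h1) (le_tangent h2) x)
      (sub_mem_shift_iff (hKL h1) (hKL h2) x)
  · rw [posFaces_shift hK, finsum_mem_image shift_injective.injOn]
    have hset : faces (ratHull u) \ {⊥} = ((finite_faces hK).toFinset.erase ⊥ : Finset _) := by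
      ext G
      simp [and_comm]
    rw [hset, finsum_mem_coe_finset]
    apply Represents.sigma_eq
    -- Passing to arbitrary series allows adding the representations of the terms.
    change SeriesRep (genSeries _) _
    rw [genSeries_shift hK hKL hdeg (hD_aff hdeg)]
    refine SeriesRep.sum _ fun G hG => ?_
    have hG' : G ∈ faces (ratHull u) := by
      simpa using Finset.mem_of_mem_erase hG
    rw [faceCone_shift hG', dim_shift]
    obtain ⟨r, hr⟩ := hσ G hG'
    rw [hr.sigma_eq]
    have := SeriesRep.zsmul hr ((-1 : ℤ) ^
      (finrank ℝ (Submodule.span ℝ (G : Set (Fin m → ℝ))) + 1))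
    simpa using this
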